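/- Let $(\Omega,P)$ be a standard Borel probability space, $Y$ an integrable real random variable, and $W,Z,U,A,X$ random variables with values in standard Borel spaces (for one generic unit: outcome $Y$, treatment $A$, covariates $X$, latent confounder $U$, negative control outcome $W$, negative control exposure $Z$). Write $F(\cdot\mid\cdot)$ for regular conditional distributions and $E(\cdot\mid\cdot)$ for the corresponding means. "For almost all $(a,x)$" refers to the law of $(A,X)$. Assume: (1) Negative control exposure: $Z\perp\!\!\!\perp Y\mid A,U,X$ and $Z\perp\!\!\!\perp W\mid A,U,X$. (2) Completeness of $W$ for $U$: for almost all $(a,x)$ and every $f\in L^2\{F(u\mid a,x)\}$, if $E\{f(U)\mid W=w,A=a,X=x\}=0$ for $F(w\mid a,x)$-almost all $w$, then $f(u)=0$ for $F(u\mid a,x)$-almost all $u$. (3) Regularity: for almost all $(a,x)$, - $F(dw,dz\mid a,x)$ has a density $\widetilde K_{a,x}(w,z)=\dfrac{dF(w,z\mid a,x)}{dF(w\mid a,x)\,dF(z\mid a,x)}$ with respect to $F(dw\mid a,x)\otimes F(dz\mid a,x)$, and $\iint \widetilde K_{a,x}(w,z)^2\,dF(w\mid a,x)\,dF(z\mid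 a,x)<\infty$ (equivalently, $\iint dF(z\mid w,a,x)\,dF(w\mid z,a,x)\,dw\,dz<\infty$); - $\int E(Y\mid a,z,x)^2\,dF(z\mid a,x)<\infty$; - $\sum_p \nu_p^{-2}\,|\langle E(Y\mid a,\cdot,x),\kappa_p\rangle|^2<\infty$, where $(\nu_p,\upsilon_p,\kappa_p)_p$ is a singular system of the operator $L^2\{F(w\mid a,x)\}\to L^2\{F(z\mid a,x)\}$, $h\mapsto E\{h(W)\mid Z=\cdot,A=a,X=x\}$ ($\nu_p>0$ the nonzero singular values with multiplicity, $\upsilon_p,\kappa_p$ orthonormal singular vectors), and the inner product is that of $L^2\{F(z\mid a,x)\}$; - $\int E(Y\mid a,u,x)^2\,dF(u\mid a,x)<\infty$. Then there is a measurable function $h^\dagger(w,a,x)$ with $h^\dagger(\cdot,a,x)\in L^2\{F(w\mid a,x)\}$ for almost all $(a,x)$, such that for almost all $(z,a,x)$ with respect to the law of $(Z,A,X)$, $h^\dagger(\cdot,a,x)$ is $F(w\mid z,a,x)$-integrable and $$E(Y\mid Z=z,A=a,X=x)=\int h^\dagger(w,a,x)\,dF(w\mid z,a,x)=E\{h^\dagger(W,a,x)\mid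 Z=z,A=a,X=x\}.$$ -/

import Mathlib

open MeasureTheory ProbabilityTheory Filter
open scoped ENNReal InnerProductSpace

noncomputable section

/-- `E(Y ∣ C = c)`: the mean of the regular conditional distribution of `Y` given `C = c`. -/
def condMean {Ω γ : Type*} [MeasurableSpace Ω] [MeasurableSpace γ]
    (P : Measure Ω) [IsFiniteMeasure P] (Y : Ω → ℝ) (C : Ω → γ) (c : γ) : ℝ :=
  ∫ y, y ∂(condDistrib Y C P c)

/-- Let `μ` be the joint law of a pair `(W, Z)`. This is the operator
`h ↦ E{h(W) ∣ Z = ·}` from `L²` of the law of `W` to `L²` of the law of `Z`, obtained by viewing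
`h(W)` as an element of `L²(μ)` and projecting it orthogonally to the functions of `Z`. -/
def condExpOp {𝒲 𝒵 : Type*} [MeasurableSpace 𝒲] [MeasurableSpace 𝒵] (μ : Measure (𝒲 × 𝒵)) :
    Lp ℝ 2 μ.fst →L[ℝ] Lp ℝ 2 μ.snd :=
  (ContinuousLinearMap.adjoint
    (Lp.compMeasurePreservingₗᵢ ℝ (E := ℝ) (p := 2) (Prod.snd : 𝒲 × 𝒵 → 𝒵)
      (⟨measurable_snd, rfl⟩ : MeasurePreserving Prod.snd μ μ.snd)).toContinuousLinearMap) ∘L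
    (Lp.compMeasurePreservingₗᵢ ℝ (E := ℝ) (p := 2) (Prod.fst : 𝒲 × 𝒵 → 𝒲)
      (⟨measurable_fst, rfl⟩ : MeasurePreserving Prod.fst μ μ.fst)).toContinuousLinearMap

/-- The defining property of the conditional expectation: `E[E{h(W) ∣ Z} g(Z)] = E[h(W) g(Z)]`
for all `g ∈ L²`. -/
theorem integral_condExpOp_mul {𝒲 𝒵 : Type*} [MeasurableSpace 𝒲] [MeasurableSpace 𝒵]
    (μ : Measure (𝒲 × 𝒵)) (h : Lp ℝ 2 μ.fst) (g : Lp ℝ 2 μ.snd) :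
    ∫ z, condExpOp μ h z * g z ∂μ.snd = ∫ q, h q.1 * g q.2 ∂μ := by
  have h1 : ⟪g, condExpOp μ h⟫_ℝ = ∫ z, condExpOp μ h z * g z ∂μ.snd := by
    simp [L2.inner_def]
  rw [← h1, condExpOp, ContinuousLinearMap.comp_apply, ContinuousLinearMap.adjoint_inner_right,
    L2.inner_def]
  refine integral_congr_ae ?_
  have e1 := Lp.coeFn_compMeasurePreserving h
    (⟨measurable_fst, rfl⟩ : MeasurePreserving Prod.fst μ μ.fst)
  have e2 := Lp.coeFn_compMeasurePreserving g
    (⟨measurable_snd, rfl⟩ : MeasurePreserving Prod.snd μ μ.snd)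
  filter_upwards [e1, e2] with q hq1 hq2
  have hq1' : (Lp.compMeasurePreserving Prod.fst
    (⟨measurable_fst, rfl⟩ : MeasurePreserving Prod.fst μ μ.fst) h) q = h q.1 := hq1
  have hq2' : (Lp.compMeasurePreserving Prod.snd
    (⟨measurable_snd, rfl⟩ : MeasurePreserving Prod.snd μ μ.snd) g) q = g q.2 := hq2
  change ⟪(Lp.compMeasurePreserving Prod.snd
      (⟨measurable_snd, rfl⟩ : MeasurePreserving Prod.snd μ μ.snd) g) q,
    (Lp.compMeasurePreserving Prod.fst
      (⟨measurable_fst, rfl⟩ : MeasurePreserving Prod.fst μ μ.fst) h) q⟫_ℝ = _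
  rw [hq1', hq2']
  simp

/-- `(ν, υ, κ)` is a singular system of the bounded operator `K` between real Hilbert spaces:
the `ν p > 0` are the nonzero singular values of `K`, repeated according to multiplicity, with
orthonormal singular vectors `υ p` and `κ p`, and `K` vanishes on the orthogonal complement of
the `υ p`. The index type is arbitrary (finite if `K` has finite rank). -/
structure IsSingularSystem {H₁ H₂ : Type*}
    [NormedAddCommGroup H₁] [InnerProductSpace ℝ H₁] [CompleteSpace H₁]
    [NormedAddCommGroup H₂] [InnerProductSpace ℝ H₂] [CompleteSpace H₂]
    (K : H₁ →L[ℝ] H₂) {ι : Type} (ν : ι → ℝ) (υ : ι → H₁) (κ : ι → H₂) : Prop where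
  pos : ∀ p, 0 < ν p
  orthonormal_left : Orthonormal ℝ υ
  orthonormal_right : Orthonormal ℝ κ
  map_eq : ∀ p, K (υ p) = ν p • κ p
  adjoint_eq : ∀ p, ContinuousLinearMap.adjoint K (κ p) = ν p • υ p
  complete : ∀ f : H₁, (∀ p, ⟪υ p, f⟫_ℝ = 0) → K f = 0

section

variable {Ω 𝒲 𝒵 𝒰 𝒜 𝒳 : Type*} [MeasurableSpace Ω] [MeasurableSpace 𝒲] [MeasurableSpace 𝒵]
  [MeasurableSpace 𝒰] [MeasurableSpace 𝒜] [MeasurableSpace 𝒳]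

/-- Relevance of `W` for `U` (completeness) at `(A, X) = (a, x)`: a function `f` that is square
integrable for `F(u ∣ a, x)` and has `E{f(U) ∣ W = w, A = a, X = x} = 0` for almost all `w`
vanishes almost surely. -/
def RelevantAt [StandardBorelSpace 𝒲] [Nonempty 𝒲] [StandardBorelSpace 𝒰] [Nonempty 𝒰]
    (P : Measure Ω) [IsFiniteMeasure P] (W : Ω → 𝒲) (U : Ω → 𝒰) (A : Ω → 𝒜) (X : Ω → 𝒳)
    (a : 𝒜) (x : 𝒳) : Prop :=
  ∀ f : 𝒰 → ℝ, MemLp f 2 (condDistrib U (fun ω => (A ω, X ω)) P (a, x)) →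
    (∀ᵐ w ∂(condDistrib W (fun ω => (A ω, X ω)) P (a, x)),
      ∫ u, f u ∂(condDistrib U (fun ω => (W ω, A ω, X ω)) P (w, a, x)) = 0) →
    ∀ᵐ u ∂(condDistrib U (fun ω => (A ω, X ω)) P (a, x)), f u = 0

/-- `F(w, z ∣ a, x)`; its marginals are `F(w ∣ a, x)` and `F(z ∣ a, x)`. -/
def lawWZ [StandardBorelSpace 𝒲] [Nonempty 𝒲] [StandardBorelSpace 𝒵] [Nonempty 𝒵]
    (P : Measure Ω) [IsFiniteMeasure P] (W : Ω → 𝒲) (Z : Ω → 𝒵) (A : Ω → 𝒜) (X : Ω → 𝒳)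
    (a : 𝒜) (x : 𝒳) : Measure (𝒲 × 𝒵) :=
  condDistrib (fun ω => (W ω, Z ω)) (fun ω => (A ω, X ω)) P (a, x)

/-- The regularity conditions on the `W`–`Z` kernel and on `E(Y ∣ a, z, x)`, at
`(A, X) = (a, x)`. -/
structure RegularAt [StandardBorelSpace 𝒲] [Nonempty 𝒲] [StandardBorelSpace 𝒵] [Nonempty 𝒵]
    (P : Measure Ω) [IsFiniteMeasure P] (Y : Ω → ℝ) (W : Ω → 𝒲) (Z : Ω → 𝒵) (A : Ω → 𝒜)
    (X : Ω → 𝒳) (a : 𝒜) (x : 𝒳) : Prop where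
  /-- The kernel `dF(w, z ∣ a, x) / (dF(w ∣ a, x) dF(z ∣ a, x))` exists. -/
  absolutelyContinuous :
    lawWZ P W Z A X a x ≪ (lawWZ P W Z A X a x).fst.prod (lawWZ P W Z A X a x).snd
  /-- `∫∫ dF(z ∣ w, a, x) dF(w ∣ z, a, x) dw dz < ∞`, that is, the kernel is square integrable
  for `F(w ∣ a, x) ⊗ F(z ∣ a, x)`. -/
  kernel_sq : ∫⁻ q, ((lawWZ P W Z A X a x).rnDeriv
      ((lawWZ P W Z A X a x).fst.prod (lawWZ P W Z A X a x).snd) q) ^ 2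
      ∂((lawWZ P W Z A X a x).fst.prod (lawWZ P W Z A X a x).snd) < ∞
  /-- `∫ E(Y ∣ a, z, x)² dF(z ∣ a, x) < ∞`. -/
  mean_sq : MemLp (fun z => condMean P Y (fun ω => (Z ω, A ω, X ω)) (z, a, x)) 2
    (lawWZ P W Z A X a x).snd
  /-- `∑ₚ νₚ⁻² |⟨E(Y ∣ a, ·, x), κₚ⟩|² < ∞` for the singular system of the operator
  `h ↦ E{h(W) ∣ Z = ·, A = a, X = x}`. The sum does not depend on the choice of the system. -/
  picard : ∀ (ι : Type) (ν : ι → ℝ) (υ : ι → Lp ℝ 2 (lawWZ P W Z A X a x).fst)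
    (κ : ι → Lp ℝ 2 (lawWZ P W Z A X a x).snd),
    IsSingularSystem (condExpOp (lawWZ P W Z A X a x)) ν υ κ →
    Summable fun p => 1 / (ν p) ^ 2 *
      |∫ z, condMean P Y (fun ω => (Z ω, A ω, X ω)) (z, a, x) * κ p z
        ∂(lawWZ P W Z A X a x).snd| ^ 2

end

end

/-! Fix `c = (a, x)`, put `m(z) = E(Y ∣ z, c)` and let `K` be the operator `h ↦ E{h(W) ∣ Z = ·, c}`.
The equation `K h = m` is solved by Picard's criterion (`RegularAt.exists_condExpOp_eq`): the square
integrable density makes `K` Hilbert–Schmidt, hence a singular system exists, and it remains to see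
that `m ⊥ ker K†`. If `K† g = 0`, set `f(u) = E{g(Z) ∣ u, c}`. Independence of `Z` and `W` given `U`
yields `E{f(U) ∣ W} = E{g(Z) ∣ W} = 0`, so `f = 0` by completeness. Independence of `Z` and `Y`
given `U` yields `m(Z) = E{b(U) ∣ Z}` with `b(u) = E(Y ∣ u, c)`, so `⟨m, g⟩ = E{b(U) f(U)} = 0`
(`integral_mul_eq_zero_of_adjoint_condExpOp_eq_zero`).

Solutions found separately for each `c` need not be measurable in `c`. Instead of selecting them,
`exists_measurable_eq_integral_condDistrib` keeps only the inequality `⟨m, g⟩² ≤ M(c) ‖E{g(Z) ∣ W,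
c}‖²` that they imply. A constant that serves a countable dense family of `g` can be chosen
measurably in `c`; a positive weight `v(c)` scales it below 1. Douglas' criterion for the law of
`((W, C), (Z, C))` then solves the equation for `v m` in one stroke, and dividing by `v` gives the
bridge function. -/

/-! ### Compact operators, singular systems and range criteria in Hilbert space. -/

section HilbertSpace

variable {H₁ H₂ : Type*}
  [NormedAddCommGroup H₁] [InnerProductSpace ℝ H₁]
  [NormedAddCommGroup H₂] [InnerProductSpace ℝ H₂] [CompleteSpace H₂]

/-- A Hilbert–Schmidt operator is compact. -/
theorem isCompactOperator_of_sum_norm_sq_le {ι : Type*} (e : HilbertBasis ι ℝ H₁)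
    (K : H₁ →L[ℝ] H₂) (C : ℝ) (hC : ∀ s : Finset ι, ∑ i ∈ s, ‖K (e i)‖ ^ 2 ≤ C) :
    IsCompactOperator K := by
  have hsum : Summable fun i => ‖K (e i)‖ ^ 2 := summable_of_sum_le (fun i => sq_nonneg _) hC
  -- Finite-rank truncations of `K` along the basis. By Cauchy–Schwarz and Bessel, the tail of `∑ ‖K
  -- eᵢ‖²` controls their operator-norm distance to `K`.
  let F : Finset ι → H₁ →L[ℝ] H₂ := fun s => ∑ i ∈ s, (innerSL ℝ (e i)).smulRight (K (e i))
  have hF : ∀ s f, F s f = ∑ i ∈ s, ⟪e i, f⟫_ℝ • K (e i) := fun s f => by simp [F]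
  classical
  have hlim : Tendsto F atTop (nhds K) := by
    rw [tendsto_iff_norm_sub_tendsto_zero, Metric.tendsto_atTop]
    intro ε hε
    obtain ⟨s, hs⟩ := summable_iff_vanishing_norm.1 hsum ((ε / 2) ^ 2) (by positivity)
    refine ⟨s, fun t ht => ?_⟩
    have hbound : ‖F t - K‖ ≤ ε / 2 := by
      refine ContinuousLinearMap.opNorm_le_bound _ (by positivity) fun f => ?_
      have hf : HasSum (fun i => ⟪e i, f⟫_ℝ • K (e i)) (K f) := by
        have h1 := (e.hasSum_repr f).mapL K
        simpa [e.repr_apply_apply] using h1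
      have hlim' : Tendsto (fun r => ‖F t f - F r f‖) atTop (nhds ‖(F t - K) f‖) := by
        refine (tendsto_const_nhds.sub ?_).norm
        simp only [hF]
        exact hf
      refine le_of_tendsto hlim' ?_
      filter_upwards [eventually_ge_atTop t] with r hr
      rw [norm_sub_rev, hF, hF, ← Finset.sum_sdiff_eq_sub hr]
      have h2 : ∑ i ∈ r \ t, ‖K (e i)‖ ^ 2 ≤ (ε / 2) ^ 2 := by
        have := hs (r \ t) (Finset.disjoint_of_subset_right ht Finset.sdiff_disjoint)
        exact (le_abs_self _).trans this.le
      have h3 : ∑ i ∈ r \ t, |⟪e i, f⟫_ℝ| ^ 2 ≤ ‖f‖ ^ 2 :=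
        e.orthonormal.sum_inner_products_le f
      refine abs_le_of_sq_le_sq' (b := ε / 2 * ‖f‖) ?_ (by positivity) |>.2
      calc ‖∑ i ∈ r \ t, ⟪e i, f⟫_ℝ • K (e i)‖ ^ 2
          ≤ (∑ i ∈ r \ t, |⟪e i, f⟫_ℝ| * ‖K (e i)‖) ^ 2 := by
            gcongr
            refine (norm_sum_le _ _).trans_eq ?_
            simp [norm_smul]
        _ ≤ (∑ i ∈ r \ t, |⟪e i, f⟫_ℝ| ^ 2) * ∑ i ∈ r \ t, ‖K (e i)‖ ^ 2 :=
            Finset.sum_mul_sq_le_sq_mul_sq _ _ _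
        _ ≤ ‖f‖ ^ 2 * (ε / 2) ^ 2 := by gcongr
        _ = (ε / 2 * ‖f‖) ^ 2 := by ring
    simpa using hbound.trans_lt (half_lt_self hε)
  refine isCompactOperator_of_tendsto hlim (Eventually.of_forall fun s => ?_)
  have h1 : IsCompactOperator (id : ℝ → ℝ) := by
    rw [isCompactOperator_id_iff_finiteDimensional (𝕜 := ℝ)]
    infer_instance
  have h2 : ∀ i ∈ s, (innerSL ℝ (e i)).smulRight (K (e i)) ∈
      compactOperator (RingHom.id ℝ) H₁ H₂ := fun i _ =>
    (h1.comp_clm (innerSL ℝ (e i))).clm_comp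
      ((ContinuousLinearMap.id ℝ ℝ).smulRight (K (e i)))
  exact (compactOperator (RingHom.id ℝ) H₁ H₂).sum_mem h2

variable [CompleteSpace H₁]

/-- A compact operator between real Hilbert spaces has a singular system. -/
theorem exists_isSingularSystem_of_isCompactOperator {K : H₁ →L[ℝ] H₂} (hK : IsCompactOperator K) :
    ∃ (ι : Type) (ν : ι → ℝ) (υ : ι → H₁) (κ : ι → H₂), IsSingularSystem K ν υ κ := by
  -- The right singular vectors are eigenvectors of `K†K` for its nonzero eigenvalues, and the
  -- singular values are the square roots of those eigenvalues.
  let T : H₁ →L[ℝ] H₁ := ContinuousLinearMap.adjoint K ∘L K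
  have hTin : ∀ f g, ⟪T f, g⟫_ℝ = ⟪K f, K g⟫_ℝ := fun f g => by
    simp [T, ContinuousLinearMap.adjoint_inner_left]
  have hTc : IsCompactOperator T := hK.clm_comp (ContinuousLinearMap.adjoint K)
  have hTs : (T : H₁ →ₗ[ℝ] H₁).IsSymmetric := fun f g => by
    change ⟪T f, g⟫_ℝ = ⟪f, T g⟫_ℝ
    rw [hTin, real_inner_comm (T g), hTin, real_inner_comm]
  have hfd : ∀ μ : {μ : ℝ // μ ≠ 0},
      FiniteDimensional ℝ (Module.End.eigenspace (T : H₁ →ₗ[ℝ] H₁) μ.1) := fun μ =>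
    ContinuousLinearMap.finite_dimensional_eigenspace hTc μ.1 μ.2
  let b := fun μ : {μ : ℝ // μ ≠ 0} =>
    stdOrthonormalBasis ℝ (Module.End.eigenspace (T : H₁ →ₗ[ℝ] H₁) μ.1)
  -- Indexing by eigenvalue and basis number keeps `ι` in `Type`, whatever the universe of `H₁`.
  let ι := Σ μ : {μ : ℝ // μ ≠ 0},
    Fin (Module.finrank ℝ (Module.End.eigenspace (T : H₁ →ₗ[ℝ] H₁) μ.1))
  let υ : ι → H₁ := fun p => (b p.1 p.2 : H₁)
  have hυ : Orthonormal ℝ υ :=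
    (hTs.orthogonalFamily_eigenspaces.comp Subtype.val_injective).orthonormal_sigma_orthonormal
      (v_family := fun μ i => b μ i) fun μ => (b μ).orthonormal
  have hTυ : ∀ p, T (υ p) = p.1.1 • υ p := fun p =>
    Module.End.mem_eigenspace_iff.1 (b p.1 p.2).2
  have hKυ : ∀ p q, ⟪K (υ p), K (υ q)⟫_ℝ = p.1.1 * ⟪υ p, υ q⟫_ℝ := fun p q => by
    rw [← hTin, hTυ, real_inner_smul_left]
  have hpos : ∀ p : ι, 0 < p.1.1 := fun p => by
    have h1 := hKυ p p
    rw [real_inner_self_eq_norm_sq, real_inner_self_eq_norm_sq, hυ.1 p] at h1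
    have h2 : 0 ≤ p.1.1 := by nlinarith [sq_nonneg ‖K (υ p)‖]
    exact lt_of_le_of_ne h2 p.1.2.symm
  have hsq : ∀ p : ι, √p.1.1 * √p.1.1 = p.1.1 := fun p => Real.mul_self_sqrt (hpos p).le
  have hs : ∀ p : ι, √p.1.1 ≠ 0 := fun p => (Real.sqrt_pos.2 (hpos p)).ne'
  refine ⟨ι, fun p => √p.1.1, υ, fun p => (√p.1.1)⁻¹ • K (υ p),
    fun p => Real.sqrt_pos.2 (hpos p), hυ, ?_, fun p => ?_, fun p => ?_, fun f hf => ?_⟩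
  · classical
    rw [orthonormal_iff_ite]
    intro p q
    rw [real_inner_smul_left, real_inner_smul_right, hKυ, orthonormal_iff_ite.1 hυ p q]
    split_ifs with h
    · subst h
      have := hs p
      field_simp
      rw [Real.sq_sqrt (hpos p).le]
    · simp
  · rw [smul_smul, mul_inv_cancel₀ (hs p), one_smul]
  · have h1 : ContinuousLinearMap.adjoint K (K (υ p)) = p.1.1 • υ p := hTυ p
    rw [map_smul, h1, smul_smul]
    congr 1
    have := hs p
    field_simp
    exact (Real.sq_sqrt (hpos p).le).symm
  -- Completeness: `T f` is orthogonal to every eigenspace, to that of 0 by symmetry and to the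
  -- others because the `υ p` span them. The spectral theorem gives `T f = 0`, and `‖K f‖² = ⟪T f,
  -- f⟫`.
  · have hv : ∀ (μ : ℝ), ∀ v ∈ Module.End.eigenspace (T : H₁ →ₗ[ℝ] H₁) μ, ⟪v, T f⟫_ℝ = 0 := by
      intro μ v hv
      have h1 : ⟪v, T f⟫_ℝ = μ * ⟪v, f⟫_ℝ := by
        rw [← real_inner_smul_left, ← Module.End.mem_eigenspace_iff.1 hv]
        exact (hTs v f).symm
      by_cases hμ : μ = 0
      · rw [h1, hμ, zero_mul]
      · have h2 := (b ⟨μ, hμ⟩).sum_repr' ⟨v, hv⟩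
        have h3 : v = ∑ i, ⟪b ⟨μ, hμ⟩ i, ⟨v, hv⟩⟫_ℝ • (b ⟨μ, hμ⟩ i : H₁) := by
          conv_lhs => rw [show v = ((⟨v, hv⟩ :
            Module.End.eigenspace (T : H₁ →ₗ[ℝ] H₁) μ) : H₁) from rfl, ← h2]
          simp
        have h4 : ⟪v, f⟫_ℝ = 0 := by
          rw [h3, sum_inner]
          refine Finset.sum_eq_zero fun i _ => ?_
          rw [real_inner_smul_left, show ⟪(b ⟨μ, hμ⟩ i : H₁), f⟫_ℝ = 0 from hf ⟨⟨μ, hμ⟩, i⟩,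
            mul_zero]
        rw [h1, h4, mul_zero]
    have hmem : T f ∈ (⨆ μ, Module.End.eigenspace (T : H₁ →ₗ[ℝ] H₁) μ)ᗮ := by
      rw [← Submodule.iInf_orthogonal, Submodule.mem_iInf]
      exact fun μ => (Submodule.mem_orthogonal _ _).2 (hv μ)
    rw [ContinuousLinearMap.orthogonalComplement_iSup_eigenspaces_eq_bot hTc hTs,
      Submodule.mem_bot] at hmem
    rw [← norm_eq_zero, ← sq_eq_zero_iff, ← real_inner_self_eq_norm_sq, ← hTin, hmem,
      inner_zero_left]

/-- Picard's criterion: if `m` is orthogonal to the kernel of the adjoint and its coefficients are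
square summable after division by the singular values, then `m` lies in the range of `K`. -/
theorem IsSingularSystem.exists_apply_eq {K : H₁ →L[ℝ] H₂} {ι : Type} {ν : ι → ℝ} {υ : ι → H₁}
    {κ : ι → H₂} (hS : IsSingularSystem K ν υ κ) {m : H₂}
    (hm : ∀ g, ContinuousLinearMap.adjoint K g = 0 → ⟪m, g⟫_ℝ = 0)
    (hsum : Summable fun p => 1 / (ν p) ^ 2 * |⟪m, κ p⟫_ℝ| ^ 2) : ∃ h, K h = m := by
  let a : ι → ℝ := fun p => (ν p)⁻¹ * ⟪m, κ p⟫_ℝ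
  have ha : Summable fun p => a p • υ p := by
    refine (hS.orthonormal_left.orthogonalFamily.summable_iff_norm_sq_summable a).2 ?_
    refine hsum.congr fun p => ?_
    simp only [a, norm_mul, mul_pow, Real.norm_eq_abs, sq_abs]
    rw [inv_pow, one_div]
  obtain ⟨h, hh⟩ := ha
  refine ⟨h, ?_⟩
  have hcoef : ∀ p, ⟪υ p, h⟫_ℝ = a p := by
    intro p
    have h1 : HasSum (fun q => ⟪υ p, a q • υ q⟫_ℝ) ⟪υ p, h⟫_ℝ := hh.mapL (innerSL ℝ (υ p))
    have h2 : ⟪υ p, a p • υ p⟫_ℝ = a p := by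
      rw [real_inner_smul_right, real_inner_self_eq_norm_sq, hS.orthonormal_left.1 p]; simp
    rw [← h2]
    refine h1.unique ?_
    refine hasSum_single (f := fun q => ⟪υ p, a q • υ q⟫_ℝ) p fun q hq => ?_
    rw [real_inner_smul_right, hS.orthonormal_left.2 hq.symm, mul_zero]
  -- The residual `g` is orthogonal to all `κ p`, so `K K† g = 0` and hence `K† g = 0`. Thus `g` is
  -- orthogonal both to `m` and to the range of `K`, so to itself.
  set g := m - K h with hg
  have hgκ : ∀ p, ⟪κ p, g⟫_ℝ = 0 := by
    intro p
    rw [hg, inner_sub_right, ← ContinuousLinearMap.adjoint_inner_left, hS.adjoint_eq,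
      real_inner_smul_left, hcoef, real_inner_comm]
    have := (hS.pos p).ne'
    simp only [a]
    field_simp
    ring
  have hKg : ContinuousLinearMap.adjoint K g = 0 := by
    have h1 : K (ContinuousLinearMap.adjoint K g) = 0 := by
      refine hS.complete _ fun p => ?_
      rw [ContinuousLinearMap.adjoint_inner_right, hS.map_eq, real_inner_smul_left, hgκ, mul_zero]
    rw [← norm_eq_zero, ← sq_eq_zero_iff, ← real_inner_self_eq_norm_sq,
      ContinuousLinearMap.adjoint_inner_left, h1, inner_zero_right]
  have h2 : ⟪g, g⟫_ℝ = 0 := by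
    nth_rw 1 [hg]
    rw [inner_sub_left, hm g hKg, ← ContinuousLinearMap.adjoint_inner_right, hKg,
      inner_zero_right, sub_zero]
  exact (sub_eq_zero.1 (inner_self_eq_zero.1 h2)).symm

/-- Douglas' range criterion: an `m` with `|⟪m, g⟫| ≤ ‖K† g‖` for all `g` lies in the range
of `K`. -/
theorem exists_apply_eq_of_abs_inner_le {K : H₁ →L[ℝ] H₂} {m : H₂}
    (hm : ∀ g, |⟪m, g⟫_ℝ| ≤ ‖ContinuousLinearMap.adjoint K g‖) : ∃ h, K h = m := by
  let T : H₂ →ₗ[ℝ] H₁ := ContinuousLinearMap.adjoint K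
  -- The functional `K† g ↦ ⟪m, g⟫` has norm at most 1 on the range of `K†`. It is defined through a
  -- linear choice `s` of preimages, extended by Hahn–Banach and represented by Riesz.
  obtain ⟨s, hs⟩ := T.rangeRestrict.exists_rightInverse_of_surjective T.range_rangeRestrict
  have hTs : ∀ y : LinearMap.range T, T (s y) = y := fun y => by
    have := congrArg (fun L => ((L y : LinearMap.range T) : H₁)) hs
    simpa using this
  let φ : StrongDual ℝ (LinearMap.range T) :=
    LinearMap.mkContinuous ((innerSL ℝ m : H₂ →ₗ[ℝ] ℝ) ∘ₗ s) 1 fun y => by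
      have h1 : |⟪m, s y⟫_ℝ| ≤ ‖T (s y)‖ := hm (s y)
      rw [hTs] at h1
      simpa using h1
  obtain ⟨ψ, hψ, -⟩ := exists_extension_norm_eq (LinearMap.range T) φ
  refine ⟨(InnerProductSpace.toDual ℝ H₁).symm ψ, ?_⟩
  refine ext_inner_right ℝ fun g => ?_
  rw [← ContinuousLinearMap.adjoint_inner_right, InnerProductSpace.toDual_symm_apply]
  have h1 : ψ (T g) = ⟪m, s ⟨T g, LinearMap.mem_range_self T g⟩⟫_ℝ :=
    hψ ⟨T g, LinearMap.mem_range_self T g⟩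
  change ψ (T g) = _
  -- Two preimages of the same point differ by an element of `ker K†`, on which the bound forces
  -- `⟪m, ·⟫` to vanish.
  rw [h1, ← sub_eq_zero, ← inner_sub_right, ← abs_nonpos_iff]
  refine (hm _).trans_eq ?_
  rw [norm_eq_zero]
  change T (_ - g) = 0
  rw [map_sub, hTs, sub_self]

end HilbertSpace

/-! ### Compactness of the conditional expectation operator. -/

section CondExpOp

theorem MeasureTheory.MemLp.integrable_fun_mul {α : Type*} [MeasurableSpace α] {μ : Measure α}
    {f g : α → ℝ} (hf : MemLp f 2 μ) (hg : MemLp g 2 μ) : Integrable (fun x => f x * g x) μ :=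
  hf.integrable_mul hg

theorem inner_Lp_two_eq_integral {α : Type*} [MeasurableSpace α] {μ : Measure α}
    (f g : Lp ℝ 2 μ) : ⟪f, g⟫_ℝ = ∫ x, f x * g x ∂μ := by
  rw [L2.inner_def]
  simp [mul_comm]

variable {𝒲 𝒵 : Type*} [MeasurableSpace 𝒲] [MeasurableSpace 𝒵]

theorem inner_condExpOp (μ : Measure (𝒲 × 𝒵)) (h : Lp ℝ 2 μ.fst) (g : Lp ℝ 2 μ.snd) :
    ⟪condExpOp μ h, g⟫_ℝ = ∫ q, h q.1 * g q.2 ∂μ := by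
  rw [inner_Lp_two_eq_integral, integral_condExpOp_mul]

theorem inner_adjoint_condExpOp (μ : Measure (𝒲 × 𝒵)) (h : Lp ℝ 2 μ.fst) (g : Lp ℝ 2 μ.snd) :
    ⟪h, ContinuousLinearMap.adjoint (condExpOp μ) g⟫_ℝ = ∫ q, h q.1 * g q.2 ∂μ := by
  rw [ContinuousLinearMap.adjoint_inner_right, inner_condExpOp]

theorem MeasureTheory.MemLp.mul_prod_two {μ : Measure 𝒲} {ν : Measure 𝒵} [SFinite μ] [SFinite ν]
    {f : 𝒲 → ℝ} {g : 𝒵 → ℝ} (hf : MemLp f 2 μ) (hg : MemLp g 2 ν) :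
    MemLp (fun q : 𝒲 × 𝒵 => f q.1 * g q.2) 2 (μ.prod ν) := by
  refine (memLp_two_iff_integrable_sq (hf.1.comp_fst.mul hg.1.comp_snd)).2 ?_
  simpa only [Pi.mul_apply, mul_pow] using hf.integrable_sq.mul_prod hg.integrable_sq

/-- The conditional expectation operator is Hilbert–Schmidt, hence compact, when the joint law has
a square integrable density with respect to the product of its marginals. -/
theorem isCompactOperator_condExpOp (μ : Measure (𝒲 × 𝒵)) [IsFiniteMeasure μ]
    (hac : μ ≪ μ.fst.prod μ.snd)
    (hsq : ∫⁻ q, (μ.rnDeriv (μ.fst.prod μ.snd) q) ^ 2 ∂(μ.fst.prod μ.snd) < ∞) :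
    IsCompactOperator (condExpOp μ) := by
  let k : 𝒲 × 𝒵 → ℝ := fun q => (μ.rnDeriv (μ.fst.prod μ.snd) q).toReal
  have hk : MemLp k 2 (μ.fst.prod μ.snd) := by
    refine ⟨(Measure.measurable_rnDeriv _ _).ennreal_toReal.aestronglyMeasurable, ?_⟩
    rw [eLpNorm_lt_top_iff_lintegral_rpow_enorm_lt_top (by norm_num) (by norm_num)]
    refine lt_of_le_of_lt (lintegral_mono fun q => ?_) hsq
    simp only [ENNReal.toReal_ofNat, ENNReal.rpow_ofNat, k]
    gcongr
    rw [Real.enorm_of_nonneg ENNReal.toReal_nonneg]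
    exact ENNReal.ofReal_toReal_le
  obtain ⟨w, e, -⟩ := exists_hilbertBasis ℝ (Lp ℝ 2 μ.fst)
  refine isCompactOperator_of_sum_norm_sq_le e _ (∫ q, k q ^ 2 ∂(μ.fst.prod μ.snd)) fun s => ?_
  set K := condExpOp μ
  -- With `S = ∑ ‖K eᵢ‖²` over `s`, both `∫ k F` and, by orthonormality, `∫ F²` equal `S`; then `2 k
  -- F ≤ k² + F²` gives `S ≤ ∫ k²`.
  let F : 𝒲 × 𝒵 → ℝ := fun q => ∑ i ∈ s, e i q.1 * K (e i) q.2
  have hterm : ∀ i, MemLp (fun q : 𝒲 × 𝒵 => e i q.1 * K (e i) q.2) 2 (μ.fst.prod μ.snd) :=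
    fun i => (Lp.memLp (e i)).mul_prod_two (Lp.memLp (K (e i)))
  have hF : MemLp F 2 (μ.fst.prod μ.snd) := memLp_finsetSum s fun i _ => hterm i
  have hkF : ∑ i ∈ s, ‖K (e i)‖ ^ 2 = ∫ q, k q * F q ∂(μ.fst.prod μ.snd) := by
    simp only [F, Finset.mul_sum]
    rw [integral_finsetSum _ fun i _ => hk.integrable_fun_mul (hterm i)]
    refine Finset.sum_congr rfl fun i _ => ?_
    rw [← real_inner_self_eq_norm_sq, inner_condExpOp,
      ← integral_rnDeriv_smul hac]
    rfl
  have hFF : ∫ q, F q ^ 2 ∂(μ.fst.prod μ.snd) = ∑ i ∈ s, ‖K (e i)‖ ^ 2 := by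
    have h1 : ∀ q, F q ^ 2 = ∑ i ∈ s, ∑ j ∈ s,
        (e i q.1 * K (e i) q.2) * (e j q.1 * K (e j) q.2) := fun q => by
      rw [sq, Finset.sum_mul_sum]
    simp only [h1]
    rw [integral_finsetSum _ fun i _ => integrable_finsetSum _ fun j _ =>
      (hterm i).integrable_fun_mul (hterm j)]
    refine Finset.sum_congr rfl fun i hi => ?_
    rw [integral_finsetSum _ fun j _ => (hterm i).integrable_fun_mul (hterm j),
      Finset.sum_eq_single_of_mem i hi]
    · have h2 : ∀ q : 𝒲 × 𝒵, (e i q.1 * K (e i) q.2) * (e i q.1 * K (e i) q.2) =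
          (e i q.1 * e i q.1) * (K (e i) q.2 * K (e i) q.2) := fun q => by ring
      simp only [h2]
      rw [integral_prod_mul (fun x => e i x * e i x) (fun y => K (e i) y * K (e i) y),
        ← inner_Lp_two_eq_integral, ← inner_Lp_two_eq_integral, real_inner_self_eq_norm_sq,
        real_inner_self_eq_norm_sq, e.orthonormal.1 i]
      ring
    · intro j _ hj
      have h2 : ∀ q : 𝒲 × 𝒵, (e i q.1 * K (e i) q.2) * (e j q.1 * K (e j) q.2) =
          (e i q.1 * e j q.1) * (K (e i) q.2 * K (e j) q.2) := fun q => by ring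
      simp only [h2]
      rw [integral_prod_mul (fun x => e i x * e j x) (fun y => K (e i) y * K (e j) y),
        ← inner_Lp_two_eq_integral, e.orthonormal.2 hj.symm, zero_mul]
  have hle : ∫ q, k q * F q ∂(μ.fst.prod μ.snd) ≤
      ∫ q, (k q ^ 2 + F q ^ 2) / 2 ∂(μ.fst.prod μ.snd) := by
    refine integral_mono (hk.integrable_fun_mul hF)
      ((hk.integrable_sq.add hF.integrable_sq).div_const 2) fun q => ?_
    change k q * F q ≤ (k q ^ 2 + F q ^ 2) / 2
    nlinarith [sq_nonneg (k q - F q)]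
  rw [integral_div, integral_add hk.integrable_sq hF.integrable_sq, ← hkF, hFF] at hle
  linarith

end CondExpOp

/-! ### Square integrability under kernels. -/

section KernelIntegral

variable {α β : Type*} [MeasurableSpace α] [MeasurableSpace β]

theorem MeasureTheory.MeasurePreserving.integral_comp_of_aestronglyMeasurable {μ : Measure α}
    {ν : Measure β} {T : α → β} (hT : MeasurePreserving T μ ν) {f : β → ℝ}
    (hf : AEStronglyMeasurable f ν) : ∫ x, f (T x) ∂μ = ∫ y, f y ∂ν := by
  rw [← hT.map_eq] at hf ⊢
  exact (integral_map hT.measurable.aemeasurable hf).symm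

theorem sq_integral_le_integral_sq {μ : Measure α} [IsProbabilityMeasure μ] {f : α → ℝ}
    (hf : MemLp f 2 μ) : (∫ x, f x ∂μ) ^ 2 ≤ ∫ x, f x ^ 2 ∂μ := by
  have h := variance_nonneg f μ
  rw [variance_eq_sub hf] at h
  simpa using h

theorem sq_integral_mul_le {μ : Measure α} {f g : α → ℝ} (hf : MemLp f 2 μ) (hg : MemLp g 2 μ) :
    (∫ x, f x * g x ∂μ) ^ 2 ≤ (∫ x, f x ^ 2 ∂μ) * ∫ x, g x ^ 2 ∂μ := by
  have key : ∀ {u v : α → ℝ} (hu : MemLp u 2 μ) (hv : MemLp v 2 μ),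
      ⟪hu.toLp u, hv.toLp v⟫_ℝ = ∫ x, u x * v x ∂μ := fun hu hv => by
    rw [inner_Lp_two_eq_integral]
    refine integral_congr_ae ?_
    filter_upwards [hu.coeFn_toLp, hv.coeFn_toLp] with x h1 h2
    rw [h1, h2]
  have h := abs_real_inner_le_norm (hf.toLp f) (hg.toLp g)
  rw [key] at h
  have h1 := key hf hf
  have h2 := key hg hg
  rw [real_inner_self_eq_norm_sq] at h1 h2
  simp only [sq (f _), sq (g _)]
  rw [← h1, ← h2, ← mul_pow, ← sq_abs]
  gcongr

theorem MeasureTheory.MemLp.ae_memLp_two_of_compProd {μ : Measure α} [SFinite μ] {κ : Kernel α β}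
    [IsSFiniteKernel κ] {G : α × β → ℝ} (hG : MemLp G 2 (μ ⊗ₘ κ)) :
    ∀ᵐ a ∂μ, MemLp (fun b => G (a, b)) 2 (κ a) := by
  have h1 := (Measure.integrable_compProd_iff hG.integrable_sq.1).1 hG.integrable_sq
  have h2 : ∀ᵐ a ∂μ, AEStronglyMeasurable (fun b => G (a, b)) (κ a) :=
    AEStronglyMeasurable.ae_of_compProd (f := fun a b => G (a, b)) hG.1
  filter_upwards [h1.1, h2] with a ha ha'
  exact (memLp_two_iff_integrable_sq ha').2 ha

/-- Jensen in each fibre: the squared conditional mean is dominated by the conditional mean of the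
square, which is integrable. -/
theorem MeasureTheory.MemLp.integral_compProd {μ : Measure α} [SFinite μ] {κ : Kernel α β}
    [IsMarkovKernel κ] {G : α × β → ℝ} (hG : MemLp G 2 (μ ⊗ₘ κ)) :
    MemLp (fun a => ∫ b, G (a, b) ∂κ a) 2 μ := by
  have hm : AEStronglyMeasurable (fun a => ∫ b, G (a, b) ∂κ a) μ := by
    refine ⟨fun a => ∫ b, hG.1.mk G (a, b) ∂κ a,
      hG.1.stronglyMeasurable_mk.integral_kernel_prod_right', ?_⟩
    filter_upwards [Measure.ae_ae_of_ae_compProd hG.1.ae_eq_mk] with a ha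
    exact integral_congr_ae ha
  refine (memLp_two_iff_integrable_sq hm).2 ?_
  have h1 := ((Measure.integrable_compProd_iff hG.integrable_sq.1).1 hG.integrable_sq).2
  refine h1.mono' (hm.pow 2) ?_
  filter_upwards [hG.ae_memLp_two_of_compProd] with a ha
  have h2 := sq_integral_le_integral_sq ha
  simpa only [norm_pow, Real.norm_eq_abs, sq_abs] using h2

end KernelIntegral

/-! ### The argument at a fixed value of `(A, X)`. -/

section Pointwise

variable {𝒲 𝒵 𝒰 : Type*} [MeasurableSpace 𝒲] [MeasurableSpace 𝒵] [MeasurableSpace 𝒰]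

/-- Let `μ` be the joint law of `(W, Z)`, with `W` and `Z` conditionally independent given `U`.
If `U` is complete for `W`, then a function `m(Z) = E{b(U) ∣ Z}` is orthogonal to the kernel of the
adjoint of the conditional expectation operator. -/
theorem integral_mul_eq_zero_of_adjoint_condExpOp_eq_zero (μ : Measure (𝒲 × 𝒵))
    [IsProbabilityMeasure μ] (ρ : Measure 𝒰) [IsProbabilityMeasure ρ] (κW : Kernel 𝒰 𝒲)
    (κZ : Kernel 𝒰 𝒵) (κ : Kernel 𝒲 𝒰) (η : Kernel 𝒵 𝒰) [IsMarkovKernel κW] [IsMarkovKernel κZ]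
    [IsMarkovKernel κ] [IsMarkovKernel η]
    (hμ : (ρ ⊗ₘ (κW ×ₖ κZ)).snd = μ)
    (hκ : (ρ ⊗ₘ κW).map Prod.swap = μ.fst ⊗ₘ κ)
    (hη : (ρ ⊗ₘ κZ).map Prod.swap = μ.snd ⊗ₘ η)
    (hcomplete : ∀ f : 𝒰 → ℝ, MemLp f 2 ρ → (∀ᵐ w ∂μ.fst, ∫ u, f u ∂κ w = 0) →
      ∀ᵐ u ∂ρ, f u = 0)
    {b : 𝒰 → ℝ} (hb : MemLp b 2 ρ) {m : 𝒵 → ℝ} (hm : ∀ᵐ z ∂μ.snd, m z = ∫ u, b u ∂η z)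
    (g : Lp ℝ 2 μ.snd) (hg : ContinuousLinearMap.adjoint (condExpOp μ) g = 0) :
    ∫ z, m z * g z ∂μ.snd = 0 := by
  have hswapW : MeasurePreserving Prod.swap (ρ ⊗ₘ κW) (μ.fst ⊗ₘ κ) := ⟨measurable_swap, hκ⟩
  have hswapZ : MeasurePreserving Prod.swap (ρ ⊗ₘ κZ) (μ.snd ⊗ₘ η) := ⟨measurable_swap, hη⟩
  have hfstW : MeasurePreserving Prod.fst (ρ ⊗ₘ κW) ρ :=
    ⟨measurable_fst, Measure.fst_compProd ρ κW⟩
  have hfstZ : MeasurePreserving Prod.fst (ρ ⊗ₘ κZ) ρ :=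
    ⟨measurable_fst, Measure.fst_compProd ρ κZ⟩
  have hsndZ : MeasurePreserving Prod.snd (ρ ⊗ₘ κZ) μ.snd :=
    (⟨measurable_fst, Measure.fst_compProd μ.snd η⟩ :
      MeasurePreserving Prod.fst (μ.snd ⊗ₘ η) μ.snd).comp hswapZ
  have hfst : MeasurePreserving Prod.fst μ μ.fst := ⟨measurable_fst, rfl⟩
  have hsnd : MeasurePreserving Prod.snd μ μ.snd := ⟨measurable_snd, rfl⟩
  have hJ : MeasurePreserving Prod.snd (ρ ⊗ₘ (κW ×ₖ κZ)) μ := ⟨measurable_snd, hμ⟩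
  have hgL : MemLp g 2 μ.snd := Lp.memLp g
  have hgZ : MemLp (fun p : 𝒰 × 𝒵 => g p.2) 2 (ρ ⊗ₘ κZ) := hgL.comp_measurePreserving hsndZ
  -- `f(u) = E{g(Z) ∣ U = u}`; below, `q(w) = E{f(U) ∣ W = w}`. Completeness will give `f = 0` once
  -- `q = 0` is known.
  set f : 𝒰 → ℝ := fun u => ∫ z, g z ∂κZ u with hf_def
  have hf : MemLp f 2 ρ := hgZ.integral_compProd
  have hfW : MemLp (fun p : 𝒰 × 𝒲 => f p.1) 2 (ρ ⊗ₘ κW) := hf.comp_measurePreserving hfstW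
  have hfκ : MemLp (fun p : 𝒲 × 𝒰 => f p.2) 2 (μ.fst ⊗ₘ κ) := by
    exact hfW.comp_measurePreserving (hswapW.symm MeasurableEquiv.prodComm)
  set q : 𝒲 → ℝ := fun w => ∫ u, f u ∂κ w with hq_def
  have hq : MemLp q 2 μ.fst := hfκ.integral_compProd
  have hf0 : ∀ᵐ u ∂ρ, f u = 0 := by
    refine hcomplete f hf ?_
    have hqμ : MemLp (fun p : 𝒲 × 𝒵 => q p.1) 2 μ := hq.comp_measurePreserving hfst
    have hgμ : MemLp (fun p : 𝒲 × 𝒵 => g p.2) 2 μ := hgL.comp_measurePreserving hsnd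
    have hqκ : MemLp (fun p : 𝒲 × 𝒰 => q p.1) 2 (μ.fst ⊗ₘ κ) :=
      hq.comp_measurePreserving ⟨measurable_fst, Measure.fst_compProd μ.fst κ⟩
    have hqW : MemLp (fun p : 𝒰 × 𝒲 => q p.2) 2 (ρ ⊗ₘ κW) := hqκ.comp_measurePreserving hswapW
    -- `K† g = 0` is tested against `q` itself, since the same pairing also computes `∫ q²`.
    have h1 : ∫ p, q p.1 * g p.2 ∂μ = 0 := by
      have h := inner_adjoint_condExpOp μ (hq.toLp q) g
      rw [hg, inner_zero_right] at h
      rw [h]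
      refine integral_congr_ae ?_
      filter_upwards [hfst.quasiMeasurePreserving.ae hq.coeFn_toLp] with p hp
      rw [hp]
    have h2 : ∫ p, q p.1 * g p.2 ∂μ = ∫ w, q w ^ 2 ∂μ.fst := by
      have hint := hqμ.integrable_fun_mul hgμ
      calc ∫ p, q p.1 * g p.2 ∂μ
          = ∫ p, q p.2.1 * g p.2.2 ∂(ρ ⊗ₘ (κW ×ₖ κZ)) := by
            exact (hJ.integral_comp_of_aestronglyMeasurable hint.1).symm
        -- Conditional independence enters here: given `u`, the law of `(W, Z)` is a product, so the
        -- integral factors.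
        _ = ∫ u, (∫ w, q w ∂κW u) * f u ∂ρ := by
            refine (Measure.integral_compProd (hJ.integrable_comp_of_integrable hint)).trans ?_
            refine integral_congr_ae (Eventually.of_forall fun u => ?_)
            simp only [Kernel.prod_apply, Function.comp_apply]
            exact integral_prod_mul q g
        _ = ∫ p, q p.2 * f p.1 ∂(ρ ⊗ₘ κW) := by
            rw [Measure.integral_compProd (hqW.integrable_fun_mul hfW)]
            simp only [integral_mul_const]
        _ = ∫ p, q p.1 * f p.2 ∂(μ.fst ⊗ₘ κ) := by
            exact hswapW.integral_comp_of_aestronglyMeasurable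
              (hqκ.integrable_fun_mul hfκ).1
        _ = ∫ w, q w ^ 2 ∂μ.fst := by
            rw [Measure.integral_compProd (hqκ.integrable_fun_mul hfκ)]
            simp only [integral_const_mul, sq]
            rfl
    rw [h2] at h1
    have h3 := (integral_eq_zero_iff_of_nonneg (fun w => sq_nonneg (q w)) hq.integrable_sq).1 h1
    filter_upwards [h3] with w hw
    exact pow_eq_zero_iff two_ne_zero |>.1 hw
  have hbZ : MemLp (fun p : 𝒰 × 𝒵 => b p.1) 2 (ρ ⊗ₘ κZ) := hb.comp_measurePreserving hfstZ
  have hbg := hbZ.integrable_fun_mul hgZ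
  have hgb : Integrable (fun p : 𝒵 × 𝒰 => b p.2 * g p.1) (μ.snd ⊗ₘ η) :=
    (hswapZ.symm MeasurableEquiv.prodComm).integrable_comp_of_integrable hbg
  calc ∫ z, m z * g z ∂μ.snd = ∫ z, (∫ u, b u * g z ∂η z) ∂μ.snd := by
        refine integral_congr_ae ?_
        filter_upwards [hm] with z hz
        rw [hz, integral_mul_const]
    _ = ∫ p, b p.2 * g p.1 ∂(μ.snd ⊗ₘ η) := (Measure.integral_compProd hgb).symm
    _ = ∫ p, b p.1 * g p.2 ∂(ρ ⊗ₘ κZ) := by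
        exact (hswapZ.integral_comp_of_aestronglyMeasurable hgb.1).symm
    _ = ∫ u, b u * f u ∂ρ := by
        rw [Measure.integral_compProd hbg]
        simp only [integral_const_mul]
        rfl
    _ = 0 := by
        refine integral_eq_zero_of_ae ?_
        filter_upwards [hf0] with u hu
        rw [hu, mul_zero]; rfl

/-- An element `m` of the range of the conditional expectation operator pairs with functions `g`
of `Z` continuously for the `L²` seminorm of `E{g(Z) ∣ W}`. -/
theorem exists_sq_integral_mul_le_of_condExpOp_eq (μ : Measure (𝒲 × 𝒵)) [IsProbabilityMeasure μ]
    (θ : Kernel 𝒲 𝒵) [IsMarkovKernel θ] (hθ : μ.fst ⊗ₘ θ = μ) {m : 𝒵 → ℝ} (hm : MemLp m 2 μ.snd)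
    {h : Lp ℝ 2 μ.fst} (hh : condExpOp μ h = hm.toLp m) :
    ∃ M : ℝ, ∀ g : 𝒵 → ℝ, MemLp g 2 μ.snd →
      (∫ z, m z * g z ∂μ.snd) ^ 2 ≤ M * ∫ w, (∫ z, g z ∂θ w) ^ 2 ∂μ.fst := by
  -- The constant is `‖h‖²`: Cauchy–Schwarz applied to `⟨K h, g⟩ = E[h(W) E{g(Z) ∣ W}]`.
  refine ⟨∫ w, h w ^ 2 ∂μ.fst, fun g hg => ?_⟩
  have hsnd : MeasurePreserving Prod.snd μ μ.snd := ⟨measurable_snd, rfl⟩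
  have hfst : MeasurePreserving Prod.fst μ μ.fst := ⟨measurable_fst, rfl⟩
  have hgμ : MemLp (fun p : 𝒲 × 𝒵 => g p.2) 2 μ := hg.comp_measurePreserving hsnd
  have hhμ : MemLp (fun p : 𝒲 × 𝒵 => h p.1) 2 μ := (Lp.memLp h).comp_measurePreserving hfst
  have hint := hhμ.integrable_fun_mul hgμ
  have hk : MemLp (fun w => ∫ z, g z ∂θ w) 2 μ.fst := by
    rw [← hθ] at hgμ
    exact hgμ.integral_compProd
  have h1 : ∫ z, m z * g z ∂μ.snd = ∫ w, h w * ∫ z, g z ∂θ w ∂μ.fst := by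
    calc ∫ z, m z * g z ∂μ.snd = ∫ z, condExpOp μ h z * hg.toLp g z ∂μ.snd := by
          refine integral_congr_ae ?_
          rw [hh]
          filter_upwards [hm.coeFn_toLp, hg.coeFn_toLp] with z h1 h2
          rw [h1, h2]
      _ = ∫ p, h p.1 * g p.2 ∂μ := by
          rw [integral_condExpOp_mul]
          refine integral_congr_ae ?_
          filter_upwards [hsnd.quasiMeasurePreserving.ae hg.coeFn_toLp] with p hp
          rw [hp]
      _ = ∫ p, h p.1 * g p.2 ∂(μ.fst ⊗ₘ θ) := by rw [hθ]
      _ = ∫ w, h w * ∫ z, g z ∂θ w ∂μ.fst := by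
          rw [Measure.integral_compProd (by rwa [hθ])]
          simp only [integral_const_mul]
  rw [h1]
  exact sq_integral_mul_le (Lp.memLp h) hk

end Pointwise

/-- Serves to reorder the conditioning variables: `(A, U, X)` and `(U, A, X)` generate the same
σ-algebra. -/
theorem ProbabilityTheory.CondIndepFun.of_measurableSpace_eq {Ω α β : Type*}
    {m₁ m₂ : MeasurableSpace Ω} [mΩ : MeasurableSpace Ω] [StandardBorelSpace Ω] [MeasurableSpace α]
    [MeasurableSpace β] {P : Measure Ω} [IsFiniteMeasure P] (h : m₁ = m₂) {hm₁ : m₁ ≤ mΩ}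
    {f : Ω → α} {g : Ω → β} (hfg : CondIndepFun m₁ hm₁ f g P) (hm₂ : m₂ ≤ mΩ) :
    CondIndepFun m₂ hm₂ f g P := by
  subst h
  exact hfg

/-! ### Disintegration, Bayes' rule and conditional independence for conditional distributions. -/

section CondDistrib

variable {Ω 𝒞 α β γ : Type*} [MeasurableSpace Ω] [MeasurableSpace 𝒞] [MeasurableSpace α]
  [MeasurableSpace β] [MeasurableSpace γ] {P : Measure Ω} [IsFiniteMeasure P]

theorem MeasureTheory.Measure.compProd_comap_swap (ν : Measure (α × 𝒞)) [SFinite ν]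
    (κ : Kernel (α × 𝒞) β) [IsSFiniteKernel κ] :
    ν.map Prod.swap ⊗ₘ κ.comap Prod.swap measurable_swap =
      (ν ⊗ₘ κ).map (Prod.map Prod.swap id) := by
  ext s hs
  have hmeas : Measurable (Prod.map Prod.swap id : (α × 𝒞) × β → (𝒞 × α) × β) :=
    measurable_swap.prodMap measurable_id
  rw [Measure.compProd_apply hs, Measure.map_apply hmeas hs, Measure.compProd_apply (hmeas hs),
    lintegral_map (Kernel.measurable_kernel_prodMk_left hs) measurable_swap]
  rfl

/-- Disintegration of a conditional distribution: the law of `(S, T)` given `C` is the law of `S`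
given `C` composed with the law of `T` given `(S, C)`. -/
theorem condDistrib_prodMk_ae_eq [StandardBorelSpace α] [Nonempty α] [StandardBorelSpace β]
    [Nonempty β] {S : Ω → α} {T : Ω → β} {C : Ω → 𝒞} (hS : Measurable S) (hT : Measurable T)
    (hC : Measurable C) :
    ∀ᵐ c ∂P.map C, condDistrib (fun ω => (S ω, T ω)) C P c =
      condDistrib S C P c ⊗ₘ (condDistrib T (fun ω => (S ω, C ω)) P).sectL c := by
  have h := condDistrib_ae_eq_of_measure_eq_compProd (μ := P) C
    (κ := condDistrib S C P ⊗ₖ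
      (condDistrib T (fun ω => (S ω, C ω)) P).comap Prod.swap measurable_swap)
    (hS.prodMk hT).aemeasurable ?_
  · filter_upwards [h] with c hc
    rw [hc, Kernel.compProd_apply_eq_compProd_sectR]
    congr 1
  · rw [← Measure.compProd_assoc', compProd_map_condDistrib hS.aemeasurable]
    have h1 : P.map (fun ω => (C ω, S ω)) = (P.map fun ω => (S ω, C ω)).map Prod.swap := by
      rw [Measure.map_map measurable_swap (hS.prodMk hC)]; rfl
    rw [h1, Measure.compProd_comap_swap, compProd_map_condDistrib hT.aemeasurable,
      Measure.map_map (measurable_swap.prodMap measurable_id) ((hS.prodMk hC).prodMk hT),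
      Measure.map_map (by fun_prop)
        ((measurable_swap.prodMap measurable_id).comp ((hS.prodMk hC).prodMk hT))]
    rfl

theorem measurePreserving_swap_compProd_condDistrib [StandardBorelSpace α] [Nonempty α]
    {S : Ω → α} {C : Ω → 𝒞} (hS : Measurable S) (hC : Measurable C) :
    MeasurePreserving Prod.swap (P.map C ⊗ₘ condDistrib S C P) (P.map fun ω => (S ω, C ω)) := by
  refine ⟨measurable_swap, ?_⟩
  rw [compProd_map_condDistrib hS.aemeasurable, Measure.map_map measurable_swap (hC.prodMk hS)]
  rfl

theorem ae_ae_condDistrib_of_ae_map [StandardBorelSpace α] [Nonempty α] {S : Ω → α} {C : Ω → 𝒞}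
    (hS : Measurable S) (hC : Measurable C) {p : α × 𝒞 → Prop}
    (hp : ∀ᵐ t ∂P.map (fun ω => (S ω, C ω)), p t) :
    ∀ᵐ c ∂P.map C, ∀ᵐ s ∂condDistrib S C P c, p (s, c) :=
  Measure.ae_ae_of_ae_compProd
    ((measurePreserving_swap_compProd_condDistrib hS hC).quasiMeasurePreserving.ae hp)

/-- Bayes' rule for conditional distributions. -/
theorem map_swap_compProd_condDistrib_ae_eq [StandardBorelSpace α] [Nonempty α]
    [StandardBorelSpace β] [Nonempty β] {S : Ω → α} {T : Ω → β} {C : Ω → 𝒞} (hS : Measurable S)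
    (hT : Measurable T) (hC : Measurable C) :
    ∀ᵐ c ∂P.map C,
      (condDistrib S C P c ⊗ₘ (condDistrib T (fun ω => (S ω, C ω)) P).sectL c).map Prod.swap =
      condDistrib T C P c ⊗ₘ (condDistrib S (fun ω => (T ω, C ω)) P).sectL c := by
  have h := condDistrib_comp (mβ := inferInstance) (μ := P) C (hS.prodMk hT).aemeasurable
    (measurable_swap : Measurable (Prod.swap : α × β → β × α))
  filter_upwards [h, condDistrib_prodMk_ae_eq (P := P) hS hT hC,
    condDistrib_prodMk_ae_eq (P := P) hT hS hC] with c h1 h2 h3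
  rw [← h2, ← h3, ← Kernel.map_apply _ measurable_swap, ← h1]
  rfl

theorem fst_condDistrib_ae_eq [StandardBorelSpace α] [Nonempty α]
    [StandardBorelSpace β] [Nonempty β] {S : Ω → α} {T : Ω → β} {C : Ω → 𝒞} (hS : Measurable S)
    (hT : Measurable T) :
    ∀ᵐ c ∂P.map C, (condDistrib (fun ω => (S ω, T ω)) C P c).fst = condDistrib S C P c := by
  filter_upwards [condDistrib_comp (μ := P) C (hS.prodMk hT).aemeasurable measurable_fst]
    with c hc
  rw [Measure.fst, ← Kernel.map_apply _ measurable_fst, ← hc]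
  rfl

theorem snd_condDistrib_ae_eq [StandardBorelSpace α] [Nonempty α]
    [StandardBorelSpace β] [Nonempty β] {S : Ω → α} {T : Ω → β} {C : Ω → 𝒞} (hS : Measurable S)
    (hT : Measurable T) :
    ∀ᵐ c ∂P.map C, (condDistrib (fun ω => (S ω, T ω)) C P c).snd = condDistrib T C P c := by
  filter_upwards [condDistrib_comp (μ := P) C (hS.prodMk hT).aemeasurable measurable_snd]
    with c hc
  rw [Measure.snd, ← Kernel.map_apply _ measurable_snd, ← hc]
  rfl

theorem stronglyMeasurable_condMean (P : Measure Ω) [IsFiniteMeasure P] (Y : Ω → ℝ) (C : Ω → 𝒞) :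
    StronglyMeasurable (condMean P Y C) :=
  StronglyMeasurable.integral_condDistrib (f := fun p : 𝒞 × ℝ => p.2)
    measurable_snd.stronglyMeasurable

section CondIndep

variable [StandardBorelSpace Ω]

/-- If `S` and `T` are conditionally independent given `(R, C)`, then given `C`, the law of `(S, T)`
is the mixture over `R` of products of the conditional laws. -/
theorem ProbabilityTheory.CondIndepFun.snd_compProd_prod_condDistrib_ae_eq [StandardBorelSpace α]
    [Nonempty α] [StandardBorelSpace β] [Nonempty β] [StandardBorelSpace γ] [Nonempty γ]
    {R : Ω → γ} {S : Ω → α} {T : Ω → β} {C : Ω → 𝒞}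
    (hR : Measurable R) (hS : Measurable S) (hT : Measurable T) (hC : Measurable C)
    (hind : CondIndepFun (MeasurableSpace.comap (fun ω => (R ω, C ω)) inferInstance)
      (hR.prodMk hC).comap_le S T P) :
    ∀ᵐ c ∂P.map C, (condDistrib R C P c ⊗ₘ
      ((condDistrib S (fun ω => (R ω, C ω)) P).sectL c ×ₖ
        (condDistrib T (fun ω => (R ω, C ω)) P).sectL c)).snd =
      condDistrib (fun ω => (S ω, T ω)) C P c := by
  rw [condIndepFun_iff_map_prod_eq_prod_condDistrib_prod_condDistrib hS hT (hR.prodMk hC),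
    ← Measure.compProd_eq_comp_prod,
    ← condDistrib_ae_eq_iff_measure_eq_compProd _ (hS.prodMk hT).aemeasurable] at hind
  filter_upwards [ae_ae_condDistrib_of_ae_map hR hC hind,
    condDistrib_prodMk_ae_eq (P := P) hR (hS.prodMk hT) hC,
    snd_condDistrib_ae_eq (P := P) (C := C) hR (hS.prodMk hT)] with c h1 h2 h3
  rw [← h3, h2]
  congr 1
  refine Measure.compProd_congr ?_
  filter_upwards [h1] with r hr
  rw [Kernel.sectL_apply, hr, Kernel.prod_apply, Kernel.prod_apply]
  rfl

/-- If `Z` and `Y` are conditionally independent given `(U, C)`, then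
`E(Y ∣ Z, C) = E{E(Y ∣ U, C) ∣ Z, C}`. -/
theorem ProbabilityTheory.CondIndepFun.condMean_ae_eq_integral [StandardBorelSpace α]
    [Nonempty α] [StandardBorelSpace γ] [Nonempty γ] {Y : Ω → ℝ} {Z : Ω → α} {U : Ω → γ} {C : Ω → 𝒞}
    (hU : Measurable U) (hZ : Measurable Z) (hY : Measurable Y) (hC : Measurable C)
    (hYint : Integrable Y P)
    (hind : CondIndepFun (MeasurableSpace.comap (fun ω => (U ω, C ω)) inferInstance)
      (hU.prodMk hC).comap_le Z Y P) :
    ∀ᵐ t ∂P.map (fun ω => (Z ω, C ω)), condMean P Y (fun ω => (Z ω, C ω)) t =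
      ∫ u, condMean P Y (fun ω => (U ω, C ω)) (u, t.2) ∂condDistrib U (fun ω => (Z ω, C ω)) P t := by
  set b := condMean P Y (fun ω => (U ω, C ω)) with hb_def
  have hb : StronglyMeasurable b := stronglyMeasurable_condMean P Y _
  have hF : StronglyMeasurable fun q : (α × 𝒞) × γ => b (q.2, q.1.2) :=
    hb.comp_measurable (by fun_prop)
  have hZC : Measurable fun ω => (Z ω, C ω) := hZ.prodMk hC
  have hT : Measurable fun ω => ((U ω, C ω), Z ω) := (hU.prodMk hC).prodMk hZ
  -- Independence says that `F(y ∣ u, c, z)` does not depend on `z`, so `E(Y ∣ U, C, Z) = b(U, C)`;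
  -- the tower property then conditions down to `(Z, C)`.
  rw [condIndepFun_iff_condDistrib_prod_ae_eq_prodMkRight hY hZ (hU.prodMk hC)] at hind
  have h1 : P[Y | MeasurableSpace.comap (fun ω => ((U ω, C ω), Z ω)) inferInstance] =ᵐ[P]
      fun ω => b (U ω, C ω) := by
    refine (condExp_ae_eq_integral_condDistrib' hT hYint).trans ?_
    filter_upwards [ae_of_ae_map hT.aemeasurable hind] with ω hω
    rw [hω]
    rfl
  have hbint : Integrable (fun ω => b (U ω, C ω)) P := integrable_condExp.congr h1
  have hle : MeasurableSpace.comap (fun ω => (Z ω, C ω)) inferInstance ≤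
      MeasurableSpace.comap (fun ω => ((U ω, C ω), Z ω)) inferInstance := by
    refine Measurable.comap_le ?_
    exact (measurable_snd.prodMk (measurable_snd.comp measurable_fst) :
      Measurable fun q : (γ × 𝒞) × α => (q.2, q.1.2)).comp (comap_measurable _)
  have h2 : P[Y | MeasurableSpace.comap (fun ω => (Z ω, C ω)) inferInstance] =ᵐ[P]
      P[fun ω => b (U ω, C ω) | MeasurableSpace.comap (fun ω => (Z ω, C ω)) inferInstance] :=
    (condExp_condExp_of_le hle hT.comap_le).symm.trans (condExp_congr_ae h1)
  have h3 := condExp_prod_ae_eq_integral_condDistrib hZC hU.aemeasurable hF hbint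
  have h4 := condExp_ae_eq_integral_condDistrib' hZC hYint
  rw [ae_map_iff hZC.aemeasurable (measurableSet_eq_fun
    (stronglyMeasurable_condMean P Y _).measurable hF.integral_condDistrib.measurable)]
  exact h4.symm.trans (h2.trans h3)

end CondIndep

end CondDistrib

/-! ### The operator and its adjoint as integrals against conditional distributions. -/

section CondDistribIntegral

variable {Ω 𝒞 α β γ : Type*} [MeasurableSpace Ω] [MeasurableSpace 𝒞] [MeasurableSpace α]
  [MeasurableSpace β] [MeasurableSpace γ] {P : Measure Ω} [IsFiniteMeasure P]

theorem integral_map_prodMk_eq_integral_condDistrib [StandardBorelSpace α] [Nonempty α] {S : Ω → α}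
    {C : Ω → 𝒞} (hS : Measurable S) (hC : Measurable C) {F : α × 𝒞 → ℝ}
    (hF : Integrable F (P.map fun ω => (S ω, C ω))) :
    ∫ t, F t ∂P.map (fun ω => (S ω, C ω)) =
      ∫ c, ∫ s, F (s, c) ∂condDistrib S C P c ∂P.map C := by
  have hmp := measurePreserving_swap_compProd_condDistrib (P := P) hS hC
  rw [← hmp.integral_comp_of_aestronglyMeasurable hF.1]
  exact Measure.integral_compProd (hmp.integrable_comp_of_integrable hF)

theorem MeasureTheory.MemLp.ae_memLp_two_condDistrib [StandardBorelSpace α] [Nonempty α]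
    {S : Ω → α} {C : Ω → 𝒞} (hS : Measurable S) (hC : Measurable C) {F : α × 𝒞 → ℝ}
    (hF : MemLp F 2 (P.map fun ω => (S ω, C ω))) :
    ∀ᵐ c ∂P.map C, MemLp (fun s => F (s, c)) 2 (condDistrib S C P c) :=
  (hF.comp_measurePreserving
    (measurePreserving_swap_compProd_condDistrib hS hC)).ae_memLp_two_of_compProd

theorem MeasureTheory.MemLp.integral_condDistrib [StandardBorelSpace β] [Nonempty β] {T : Ω → α}
    {S : Ω → β} (hT : Measurable T) (hS : Measurable S) {G : α × β → ℝ}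
    (hG : StronglyMeasurable G) (hG2 : MemLp (fun ω => G (T ω, S ω)) 2 P) :
    MemLp (fun t => ∫ s, G (t, s) ∂condDistrib S T P t) 2 (P.map T) := by
  have h : MemLp G 2 (P.map T ⊗ₘ condDistrib S T P) := by
    rw [compProd_map_condDistrib hS.aemeasurable,
      memLp_map_measure_iff hG.aestronglyMeasurable (hT.prodMk hS).aemeasurable]
    exact hG2
  exact h.integral_compProd

theorem integral_mul_integral_condDistrib [StandardBorelSpace β] [Nonempty β] {T : Ω → α}
    {S : Ω → β} (hT : Measurable T) (hS : Measurable S) {G : α × β → ℝ}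
    (hG : StronglyMeasurable G) (hG2 : MemLp (fun ω => G (T ω, S ω)) 2 P) {h : α → ℝ}
    (hh : StronglyMeasurable h) (hh2 : MemLp (fun ω => h (T ω)) 2 P) :
    ∫ t, h t * ∫ s, G (t, s) ∂condDistrib S T P t ∂P.map T = ∫ ω, h (T ω) * G (T ω, S ω) ∂P := by
  have hmp : MeasurePreserving (fun ω => (T ω, S ω)) P (P.map T ⊗ₘ condDistrib S T P) :=
    ⟨hT.prodMk hS, (compProd_map_condDistrib hS.aemeasurable).symm⟩
  have hFm : StronglyMeasurable fun q : α × β => h q.1 * G q :=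
    (hh.comp_measurable measurable_fst).mul hG
  have hF : Integrable (fun q : α × β => h q.1 * G q) (P.map T ⊗ₘ condDistrib S T P) :=
    (hmp.integrable_comp hFm.aestronglyMeasurable).1 (hh2.integrable_fun_mul hG2)
  rw [hmp.integral_comp_of_aestronglyMeasurable hF.1, Measure.integral_compProd hF]
  simp only [integral_const_mul]

variable [StandardBorelSpace β] [Nonempty β] {T : Ω → α} {V : Ω → γ} {S : Ω → β}

/-- The conditional expectation operator of the joint law of `(T, V)`, where `T` is a function of
`(V, S)`, integrates against the conditional distribution of `S` given `V`. -/
theorem condExpOp_ae_eq (hT : Measurable T) (hV : Measurable V) (hS : Measurable S)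
    {μ : Measure (α × γ)} (hTV : MeasurePreserving (fun ω => (T ω, V ω)) P μ)
    {ψ : γ × β → α} (hψ : Measurable ψ) (hTψ : ∀ ω, T ω = ψ (V ω, S ω))
    (h : Lp ℝ 2 μ.fst) :
    condExpOp μ h =ᵐ[μ.snd]
      fun v => ∫ s, h (ψ (v, s)) ∂condDistrib S V P v := by
  have hfstp : MeasurePreserving Prod.fst μ μ.fst := ⟨measurable_fst, rfl⟩
  have hsndp : MeasurePreserving Prod.snd μ μ.snd := ⟨measurable_snd, rfl⟩
  have hsnd : μ.snd = P.map V := by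
    rw [← hTV.map_eq, Measure.snd_map_prodMk hT]
  have hhT : MemLp (fun ω => h (T ω)) 2 P :=
    (Lp.memLp h).comp_measurePreserving (hfstp.comp hTV)
  have hG2 : MemLp (fun ω => h (ψ (V ω, S ω))) 2 P := by
    simpa only [← hTψ] using hhT
  have hG : StronglyMeasurable fun q : γ × β => h (ψ q) :=
    (Lp.stronglyMeasurable h).comp_measurable hψ
  have hk : MemLp (fun v => ∫ s, h (ψ (v, s)) ∂condDistrib S V P v) 2 μ.snd := by
    rw [hsnd]
    exact hG2.integral_condDistrib hV hS hG
  suffices condExpOp μ h = hk.toLp _ by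
    rw [this]; exact hk.coeFn_toLp
  -- Both sides have the same pairing with every `g(V)`. The map `ψ` lets `T` and `V` share a
  -- component, as `(W, C)` and `(Z, C)` do.
  refine ext_inner_right ℝ fun g => ?_
  have hgV : MemLp (fun ω => g (V ω)) 2 P :=
    (Lp.memLp g).comp_measurePreserving (hsndp.comp hTV)
  have h1 := integral_mul_integral_condDistrib hV hS hG hG2 (Lp.stronglyMeasurable g) hgV
  rw [inner_condExpOp, inner_Lp_two_eq_integral, ← hTV.integral_comp_of_aestronglyMeasurable]
  · rw [← hsnd] at h1
    simp only [← hTψ] at h1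
    simp only [mul_comm (h _)]
    rw [← h1]
    refine integral_congr_ae ?_
    filter_upwards [hk.coeFn_toLp] with v hv
    rw [hv, mul_comm]
  · exact ((Lp.stronglyMeasurable h).comp_measurable measurable_fst).mul
      ((Lp.stronglyMeasurable g).comp_measurable measurable_snd) |>.aestronglyMeasurable

/-- The adjoint of the conditional expectation operator of the joint law of `(T, V)`, where `V` is a
function of `(T, S)`, integrates against the conditional distribution of `S` given `T`. -/
theorem adjoint_condExpOp_ae_eq (hT : Measurable T) (hV : Measurable V) (hS : Measurable S)
    {μ : Measure (α × γ)} (hTV : MeasurePreserving (fun ω => (T ω, V ω)) P μ)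
    {ψ : α × β → γ} (hψ : Measurable ψ) (hVψ : ∀ ω, V ω = ψ (T ω, S ω))
    (g : Lp ℝ 2 μ.snd) :
    ContinuousLinearMap.adjoint (condExpOp μ) g
      =ᵐ[μ.fst]
      fun t => ∫ s, g (ψ (t, s)) ∂condDistrib S T P t := by
  have hfstp : MeasurePreserving Prod.fst μ μ.fst := ⟨measurable_fst, rfl⟩
  have hsndp : MeasurePreserving Prod.snd μ μ.snd := ⟨measurable_snd, rfl⟩
  have hfst : μ.fst = P.map T := by
    rw [← hTV.map_eq, Measure.fst_map_prodMk hV]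
  have hgV : MemLp (fun ω => g (V ω)) 2 P :=
    (Lp.memLp g).comp_measurePreserving (hsndp.comp hTV)
  have hG2 : MemLp (fun ω => g (ψ (T ω, S ω))) 2 P := by
    simpa only [← hVψ] using hgV
  have hG : StronglyMeasurable fun q : α × β => g (ψ q) :=
    (Lp.stronglyMeasurable g).comp_measurable hψ
  have hk : MemLp (fun t => ∫ s, g (ψ (t, s)) ∂condDistrib S T P t) 2 μ.fst := by
    rw [hfst]
    exact hG2.integral_condDistrib hT hS hG
  suffices ContinuousLinearMap.adjoint (condExpOp μ) g = hk.toLp _ by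
    rw [this]; exact hk.coeFn_toLp
  refine ext_inner_left ℝ fun h => ?_
  have hhT : MemLp (fun ω => h (T ω)) 2 P :=
    (Lp.memLp h).comp_measurePreserving (hfstp.comp hTV)
  have h1 := integral_mul_integral_condDistrib hT hS hG hG2 (Lp.stronglyMeasurable h) hhT
  rw [inner_adjoint_condExpOp, inner_Lp_two_eq_integral,
    ← hTV.integral_comp_of_aestronglyMeasurable]
  · rw [← hfst] at h1
    simp only [← hVψ] at h1
    rw [← h1]
    refine integral_congr_ae ?_
    filter_upwards [hk.coeFn_toLp] with v hv
    rw [hv]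
  · exact ((Lp.stronglyMeasurable h).comp_measurable measurable_fst).mul
      ((Lp.stronglyMeasurable g).comp_measurable measurable_snd) |>.aestronglyMeasurable

end CondDistribIntegral

/-! ### A jointly measurable solution without measurable selection. -/

section MeasurableSolution

variable {Ω 𝒲 𝒵 𝒞 : Type*} [MeasurableSpace Ω] [MeasurableSpace 𝒲] [StandardBorelSpace 𝒲]
  [Nonempty 𝒲] [MeasurableSpace 𝒵] [StandardBorelSpace 𝒵] [Nonempty 𝒵] [MeasurableSpace 𝒞]
  [StandardBorelSpace 𝒞] {P : Measure Ω} [IsProbabilityMeasure P]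

/-- Suppose that for almost every `c` the functional `g ↦ ∫ m(z, c) g(z) dF(z ∣ c)` is bounded for
the seminorm `g ↦ ‖E{g(Z) ∣ W = ·, C = c}‖`. Then the equation `m(z, c) = ∫ h(w, c) dF(w ∣ z, c)`
has a solution `h` which is jointly measurable and square integrable for almost every `c`. -/
theorem exists_measurable_eq_integral_condDistrib {W : Ω → 𝒲} {Z : Ω → 𝒵} {C : Ω → 𝒞}
    (hW : Measurable W) (hZ : Measurable Z) (hC : Measurable C) {m : 𝒵 × 𝒞 → ℝ}
    (hm : StronglyMeasurable m)
    (hm2 : ∀ᵐ c ∂P.map C, MemLp (fun z => m (z, c)) 2 (condDistrib Z C P c))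
    (hrange : ∀ᵐ c ∂P.map C, ∃ M : ℝ, ∀ g : 𝒵 → ℝ, MemLp g 2 (condDistrib Z C P c) →
      (∫ z, m (z, c) * g z ∂condDistrib Z C P c) ^ 2 ≤
        M * ∫ w, (∫ z, g z ∂condDistrib Z (fun ω => (W ω, C ω)) P (w, c)) ^ 2
          ∂condDistrib W C P c) :
    ∃ h : 𝒲 × 𝒞 → ℝ, Measurable h ∧
      (∀ᵐ c ∂P.map C, MemLp (fun w => h (w, c)) 2 (condDistrib W C P c)) ∧
      ∀ᵐ t ∂P.map (fun ω => (Z ω, C ω)),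
        Integrable (fun w => h (w, t.2)) (condDistrib W (fun ω => (Z ω, C ω)) P t) ∧
        m t = ∫ w, h (w, t.2) ∂condDistrib W (fun ω => (Z ω, C ω)) P t := by
  have hWC := hW.prodMk hC
  have hZC := hZ.prodMk hC
  have : IsProbabilityMeasure (P.map C) := Measure.isProbabilityMeasure_map hC.aemeasurable
  -- Keeping `C` in both coordinates makes the operator of this law act fibrewise over `c`, so a
  -- single Hilbert space equation encodes all the fibre equations.
  obtain ⟨μ, hμ_def⟩ : ∃ μ, μ = P.map fun ω => ((W ω, C ω), (Z ω, C ω)) := ⟨_, rfl⟩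
  have hμ : MeasurePreserving (fun ω => ((W ω, C ω), (Z ω, C ω))) P μ :=
    ⟨hWC.prodMk hZC, hμ_def.symm⟩
  have : IsProbabilityMeasure μ :=
    hμ_def ▸ Measure.isProbabilityMeasure_map (hWC.prodMk hZC).aemeasurable
  have hfst : μ.fst = P.map fun ω => (W ω, C ω) := by
    rw [hμ_def, Measure.fst_map_prodMk hZC]
  have hsnd : μ.snd = P.map fun ω => (Z ω, C ω) := by
    rw [hμ_def, Measure.snd_map_prodMk hWC]
  set K := condExpOp μ with hK
  have : Fact ((2 : ℝ≥0∞) ≠ ∞) := ⟨ENNReal.ofNat_ne_top⟩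
  obtain ⟨g, hdense⟩ := TopologicalSpace.exists_dense_seq (Lp ℝ 2 μ.snd)
  have hgm : ∀ i, StronglyMeasurable (g i) := fun i => Lp.stronglyMeasurable (g i)
  have hg2 : ∀ i, MemLp (g i) 2 (P.map fun ω => (Z ω, C ω)) := fun i =>
    (congrArg (fun ν => MemLp (g i) 2 ν) hsnd).mp (Lp.memLp (g i))
  let I : ℕ → 𝒞 → ℝ := fun i c => ∫ z, m (z, c) * g i (z, c) ∂condDistrib Z C P c
  let k : ℕ → 𝒲 × 𝒞 → ℝ := fun i t =>
    ∫ z, g i (z, t.2) ∂condDistrib Z (fun ω => (W ω, C ω)) P t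
  let N : ℕ → 𝒞 → ℝ := fun i c => ∫ w, k i (w, c) ^ 2 ∂condDistrib W C P c
  let Q : 𝒞 → ℝ := fun c => ∫ z, m (z, c) ^ 2 ∂condDistrib Z C P c
  have hIm : ∀ i, StronglyMeasurable (I i) := fun i =>
    StronglyMeasurable.integral_condDistrib (f := fun p : 𝒞 × 𝒵 => m (p.2, p.1) * g i (p.2, p.1))
      ((hm.comp_measurable measurable_swap).mul ((hgm i).comp_measurable measurable_swap))
  have hkm : ∀ i, StronglyMeasurable (k i) := fun i =>
    StronglyMeasurable.integral_condDistrib (f := fun p : (𝒲 × 𝒞) × 𝒵 => g i (p.2, p.1.2))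
      ((hgm i).comp_measurable (by fun_prop))
  have hNm : ∀ i, StronglyMeasurable (N i) := fun i =>
    StronglyMeasurable.integral_condDistrib (f := fun p : 𝒞 × 𝒲 => k i (p.2, p.1) ^ 2)
      (((hkm i).comp_measurable measurable_swap).pow 2)
  have hQm : StronglyMeasurable Q :=
    StronglyMeasurable.integral_condDistrib (f := fun p : 𝒞 × 𝒵 => m (p.2, p.1) ^ 2)
      ((hm.comp_measurable measurable_swap).pow 2)
  -- Measurable in `c` as a countable supremum. The convention `x / 0 = 0` is harmless, since `N i c
  -- = 0` forces `I i c = 0` for almost every `c`; the supremum is likewise finite almost surely.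
  let D : 𝒞 → ℝ := fun c => (⨆ i, ENNReal.ofReal (I i c ^ 2 / N i c)).toReal
  have hDm : Measurable D :=
    (Measurable.iSup fun i =>
      (((hIm i).measurable.pow_const 2).div (hNm i).measurable).ennreal_ofReal).ennreal_toReal
  have hD0 : ∀ c, 0 ≤ D c := fun c => ENNReal.toReal_nonneg
  have hQ0 : ∀ c, 0 ≤ Q c := fun c => integral_nonneg fun z => sq_nonneg _
  have hN0 : ∀ i c, 0 ≤ N i c := fun i c => integral_nonneg fun w => sq_nonneg _
  -- This weight makes both `v² D ≤ 1`, for the Douglas bound, and `v² Q ≤ 1`, for `v m` to be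
  -- globally square integrable.
  let v : 𝒞 → ℝ := fun c => (1 + D c + Q c)⁻¹
  have hvm : Measurable v := ((measurable_const.add hDm).add hQm.measurable).inv
  have hden : ∀ c, 0 < 1 + D c + Q c := fun c => by linarith [hD0 c, hQ0 c]
  have hv0 : ∀ c, 0 < v c := fun c => inv_pos.2 (hden c)
  have hv1 : ∀ c, v c ≤ 1 := fun c => inv_le_one_of_one_le₀ (by linarith [hD0 c, hQ0 c])
  have hvmul : ∀ c, v c * (1 + D c + Q c) = 1 := fun c => inv_mul_cancel₀ (hden c).ne'
  have hvD : ∀ c, v c ^ 2 * D c ≤ 1 := fun c => by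
    have h1 : v c * D c ≤ 1 := by
      rw [← hvmul c]; exact mul_le_mul_of_nonneg_left (by linarith [hQ0 c]) (hv0 c).le
    have h2 := mul_nonneg (hv0 c).le (hD0 c)
    calc v c ^ 2 * D c = v c * (v c * D c) := by ring
      _ ≤ 1 * 1 := mul_le_mul (hv1 c) h1 h2 zero_le_one
      _ = 1 := one_mul 1
  have hvQ : ∀ c, v c ^ 2 * Q c ≤ 1 := fun c => by
    have h1 : v c * Q c ≤ 1 := by
      rw [← hvmul c]; exact mul_le_mul_of_nonneg_left (by linarith [hD0 c]) (hv0 c).le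
    have h2 := mul_nonneg (hv0 c).le (hQ0 c)
    calc v c ^ 2 * Q c = v c * (v c * Q c) := by ring
      _ ≤ 1 * 1 := mul_le_mul (hv1 c) h1 h2 zero_le_one
      _ = 1 := one_mul 1
  have hI : ∀ᵐ c ∂P.map C, ∀ i, I i c ^ 2 ≤ D c * N i c := by
    have hslice : ∀ᵐ c ∂P.map C, ∀ i, MemLp (fun z => g i (z, c)) 2 (condDistrib Z C P c) :=
      ae_all_iff.2 fun i => (hg2 i).ae_memLp_two_condDistrib hZ hC
    filter_upwards [hslice, hrange] with c hc hM
    obtain ⟨M, hM⟩ := hM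
    have hIM : ∀ i, I i c ^ 2 ≤ M * N i c := fun i => hM _ (hc i)
    have hfin : (⨆ i, ENNReal.ofReal (I i c ^ 2 / N i c)) ≠ ∞ := by
      refine ne_top_of_le_ne_top (b := ENNReal.ofReal |M|) ENNReal.ofReal_ne_top
        (iSup_le fun i => ENNReal.ofReal_le_ofReal ?_)
      refine div_le_of_le_mul₀ (hN0 i c) (abs_nonneg M) ((hIM i).trans ?_)
      exact mul_le_mul_of_nonneg_right (le_abs_self M) (hN0 i c)
    intro i
    rcases (hN0 i c).eq_or_lt with h0 | hpos
    · have := hIM i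
      rw [← h0, mul_zero] at this ⊢
      exact this
    · rw [← div_le_iff₀ hpos]
      exact (ENNReal.ofReal_le_iff_le_toReal hfin).1
        (le_iSup (fun i => ENNReal.ofReal (I i c ^ 2 / N i c)) i)
  have hswap := measurePreserving_swap_compProd_condDistrib (P := P) hZ hC
  have hvm_sm : StronglyMeasurable fun t : 𝒵 × 𝒞 => v t.2 * m t :=
    (hvm.comp measurable_snd).stronglyMeasurable.mul hm
  have hvm2 : MemLp (fun t : 𝒵 × 𝒞 => v t.2 * m t) 2 μ.snd := by
    rw [hsnd]
    refine (memLp_two_iff_integrable_sq hvm_sm.aestronglyMeasurable).2 ?_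
    have hsm : StronglyMeasurable fun t : 𝒵 × 𝒞 => (v t.2 * m t) ^ 2 := hvm_sm.pow 2
    rw [← hswap.integrable_comp hsm.aestronglyMeasurable,
      Measure.integrable_compProd_iff
        (hsm.comp_measurable measurable_swap).aestronglyMeasurable]
    constructor
    · filter_upwards [hm2] with c hc
      have := (hc.const_mul (v c)).integrable_sq
      exact this
    · have heq : ∀ c, ∫ z, ‖((fun t : 𝒵 × 𝒞 => (v t.2 * m t) ^ 2) ∘ Prod.swap) (c, z)‖
          ∂condDistrib Z C P c = v c ^ 2 * Q c := fun c => by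
        simp only [Function.comp_apply, Prod.swap_prod_mk, Real.norm_of_nonneg (sq_nonneg _)]
        simp only [mul_pow, integral_const_mul, Q]
      simp only [heq]
      refine (integrable_const (1 : ℝ)).mono'
        ((hvm.pow_const 2).mul hQm.measurable).aestronglyMeasurable
        (Eventually.of_forall fun c => ?_)
      rw [Real.norm_of_nonneg (mul_nonneg (sq_nonneg _) (hQ0 c))]
      exact hvQ c
  have hbound : ∀ f : Lp ℝ 2 μ.snd,
      |⟪hvm2.toLp _, f⟫_ℝ| ≤ ‖ContinuousLinearMap.adjoint K f‖ := by
    intro f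
    -- Both sides are continuous, so the dense sequence suffices. There `⟪v m, gᵢ⟫ = ∫ v Iᵢ` and
    -- `‖K† gᵢ‖² = ∫ Nᵢ`, and the fibre bound `(v Iᵢ)² ≤ Nᵢ` is integrated using Jensen.
    refine hdense.induction_on f (isClosed_le (by fun_prop) (by fun_prop)) fun i => ?_
    have hinner : ⟪hvm2.toLp _, g i⟫_ℝ = ∫ c, v c * I i c ∂P.map C := by
      rw [inner_Lp_two_eq_integral]
      have h1 : ∫ t, hvm2.toLp _ t * g i t ∂μ.snd = ∫ t, (v t.2 * m t) * g i t ∂μ.snd := by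
        refine integral_congr_ae ?_
        filter_upwards [hvm2.coeFn_toLp] with t ht
        rw [ht]
      have hint := (congrArg (fun ν => Integrable (fun t => v t.2 * m t * g i t) ν) hsnd).mp
        (hvm2.integrable_fun_mul (Lp.memLp (g i)))
      rw [h1, congrArg (fun ν => ∫ t, v t.2 * m t * g i t ∂ν) hsnd,
        integral_map_prodMk_eq_integral_condDistrib hZ hC hint]
      simp only [mul_assoc, integral_const_mul, I]
    have hadj : ContinuousLinearMap.adjoint K (g i) =ᵐ[μ.fst] k i :=
      adjoint_condExpOp_ae_eq hWC hZC hZ hμ (ψ := fun q => (q.2, q.1.2)) (by fun_prop)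
        (fun ω => rfl) (g i)
    have hk2 : MemLp (k i) 2 (P.map fun ω => (W ω, C ω)) := by
      rw [← hfst]
      exact (Lp.memLp (ContinuousLinearMap.adjoint K (g i))).ae_eq hadj
    have hnorm : ‖ContinuousLinearMap.adjoint K (g i)‖ ^ 2 = ∫ c, N i c ∂P.map C := by
      rw [← real_inner_self_eq_norm_sq, inner_Lp_two_eq_integral,
        ← integral_map_prodMk_eq_integral_condDistrib hW hC hk2.integrable_sq, ← hfst]
      refine integral_congr_ae ?_
      filter_upwards [hadj] with t ht
      rw [ht, sq]
    have hNint : Integrable (N i) (P.map C) := by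
      have h1 := (measurePreserving_swap_compProd_condDistrib (P := P) hW hC
        ).integrable_comp_of_integrable hk2.integrable_sq
      have h2 := ((Measure.integrable_compProd_iff h1.1).1 h1).2
      refine h2.congr (Eventually.of_forall fun c => ?_)
      simp [N]
    have hsq : ∀ᵐ c ∂P.map C, (v c * I i c) ^ 2 ≤ N i c := by
      filter_upwards [hI] with c hc
      calc (v c * I i c) ^ 2 = v c ^ 2 * I i c ^ 2 := by ring
        _ ≤ v c ^ 2 * (D c * N i c) := mul_le_mul_of_nonneg_left (hc i) (sq_nonneg _)
        _ = v c ^ 2 * D c * N i c := by ring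
        _ ≤ 1 * N i c := mul_le_mul_of_nonneg_right (hvD c) (hN0 i c)
        _ = N i c := one_mul _
    have hvI : AEStronglyMeasurable (fun c => v c * I i c) (P.map C) :=
      (hvm.mul (hIm i).measurable).aestronglyMeasurable
    have hsqint : Integrable (fun c => (v c * I i c) ^ 2) (P.map C) := by
      refine hNint.mono' (hvI.pow 2) ?_
      filter_upwards [hsq] with c hc
      rwa [Real.norm_of_nonneg (sq_nonneg _)]
    refine abs_le_of_sq_le_sq ?_ (norm_nonneg _)
    rw [hinner, hnorm]
    exact (sq_integral_le_integral_sq ((memLp_two_iff_integrable_sq hvI).2 hsqint)).trans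
      (integral_mono_ae hsqint hNint hsq)
  obtain ⟨h, hh⟩ := exists_apply_eq_of_abs_inner_le hbound
  have hhm : StronglyMeasurable h := Lp.stronglyMeasurable h
  have hh2 : MemLp h 2 (P.map fun ω => (W ω, C ω)) :=
    (congrArg (fun ν => MemLp h 2 ν) hfst).mp (Lp.memLp h)
  -- As `v` depends on `c` alone, it passes through the conditional expectation given `(Z, C)`.
  -- Since `v⁻¹` may be unbounded, square integrability is claimed only in each fibre.
  refine ⟨fun t => (v t.2)⁻¹ * h t, (hvm.comp measurable_snd).inv.mul hhm.measurable, ?_, ?_⟩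
  · filter_upwards [hh2.ae_memLp_two_condDistrib hW hC] with c hc
    exact hc.const_mul _
  · have hhint : Integrable (fun q : (𝒵 × 𝒞) × 𝒲 => h (q.2, q.1.2))
        (P.map fun ω => ((Z ω, C ω), W ω)) := by
      have hhm' : StronglyMeasurable (fun q : (𝒵 × 𝒞) × 𝒲 => h (q.2, q.1.2)) :=
        hhm.comp_measurable (by fun_prop)
      rw [integrable_map_measure hhm'.aestronglyMeasurable (hZC.prodMk hW).aemeasurable]
      exact (integrable_map_measure hhm.aestronglyMeasurable hWC.aemeasurable).1
        (hh2.integrable one_le_two)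
    have hKh := condExpOp_ae_eq hWC hZC hW hμ (ψ := fun q => (q.2, q.1.2)) (by fun_prop)
        (fun ω => rfl) h
    rw [← hK, hh] at hKh
    have heq := hvm2.coeFn_toLp.symm.trans hKh
    rw [hsnd] at heq
    filter_upwards [heq, hhint.condDistrib_ae_map hW.aemeasurable] with t ht hit
    refine ⟨hit.const_mul _, ?_⟩
    rw [integral_const_mul, ← ht, inv_mul_cancel_left₀ (hv0 t.2).ne']

end MeasurableSolution

/-! ### Solvability at almost every `(a, x)`, and the theorem. -/

section Solvability

variable {Ω 𝒲 𝒵 𝒰 𝒜 𝒳 : Type*} [MeasurableSpace Ω]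
  [MeasurableSpace 𝒲] [StandardBorelSpace 𝒲] [Nonempty 𝒲]
  [MeasurableSpace 𝒵] [StandardBorelSpace 𝒵] [Nonempty 𝒵]
  [MeasurableSpace 𝒰] [StandardBorelSpace 𝒰] [Nonempty 𝒰]
  [MeasurableSpace 𝒜] [MeasurableSpace 𝒳] {P : Measure Ω} [IsProbabilityMeasure P]

/-- Under conditional independence and completeness, `E(Y ∣ a, ·, x)` is orthogonal to the kernel of
the adjoint of the operator `h ↦ E{h(W) ∣ Z = ·, A = a, X = x}`. -/
theorem ae_integral_condMean_mul_eq_zero [StandardBorelSpace Ω] {Y : Ω → ℝ} {W : Ω → 𝒲}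
    {Z : Ω → 𝒵} {U : Ω → 𝒰} {A : Ω → 𝒜} {X : Ω → 𝒳} (hW : Measurable W) (hZ : Measurable Z) (hU : Measurable U)
    (hA : Measurable A) (hX : Measurable X) (hY : Measurable Y) (hYint : Integrable Y P)
    (hZY : CondIndepFun (MeasurableSpace.comap (fun ω => (U ω, A ω, X ω)) inferInstance)
      (hU.prodMk (hA.prodMk hX)).comap_le Z Y P)
    (hZW : CondIndepFun (MeasurableSpace.comap (fun ω => (U ω, A ω, X ω)) inferInstance)
      (hU.prodMk (hA.prodMk hX)).comap_le Z W P)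
    (hrel : ∀ᵐ c ∂(P.map fun ω => (A ω, X ω)), RelevantAt P W U A X c.1 c.2)
    (hYU : ∀ᵐ c ∂(P.map fun ω => (A ω, X ω)),
      MemLp (fun u => condMean P Y (fun ω => (U ω, A ω, X ω)) (u, c.1, c.2)) 2
        (condDistrib U (fun ω => (A ω, X ω)) P c)) :
    ∀ᵐ c ∂(P.map fun ω => (A ω, X ω)), ∀ g : Lp ℝ 2 (lawWZ P W Z A X c.1 c.2).snd,
      ContinuousLinearMap.adjoint (condExpOp (lawWZ P W Z A X c.1 c.2)) g = 0 →
      ∫ z, condMean P Y (fun ω => (Z ω, A ω, X ω)) (z, c) * g z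
        ∂(lawWZ P W Z A X c.1 c.2).snd = 0 := by
  have hC : Measurable fun ω => (A ω, X ω) := hA.prodMk hX
  filter_upwards [hrel, hYU, fst_condDistrib_ae_eq (P := P) (C := fun ω => (A ω, X ω)) hW hZ,
    snd_condDistrib_ae_eq (P := P) (C := fun ω => (A ω, X ω)) hW hZ,
    hZW.symm.snd_compProd_prod_condDistrib_ae_eq hU hW hZ hC,
    map_swap_compProd_condDistrib_ae_eq (P := P) hU hW hC,
    map_swap_compProd_condDistrib_ae_eq (P := P) hU hZ hC,
    ae_ae_condDistrib_of_ae_map hZ hC (hZY.condMean_ae_eq_integral hU hZ hY hC hYint)]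
    with c hrel hb hfst hsnd hJ hBW hBZ hm g hg
  -- The fixed-point argument uses the marginals of `F(w, z ∣ c)`, which agree with `F(w ∣ c)` and
  -- `F(z ∣ c)` only for almost every `c`.
  rw [← hfst] at hBW
  rw [← hsnd] at hBZ hm
  refine integral_mul_eq_zero_of_adjoint_condExpOp_eq_zero
    (condDistrib (fun ω => (W ω, Z ω)) (fun ω => (A ω, X ω)) P c) _ _ _ _ _ hJ hBW hBZ ?_ hb hm g hg
  intro f hf hf0
  refine hrel f hf ?_
  rw [hfst] at hf0
  exact hf0

/-- At a regular point the equation `E(Y ∣ a, z, x) = E{h(W) ∣ Z = z, A = a, X = x}` is solvable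
in `h ∈ L²{F(w ∣ a, x)}`. -/
theorem RegularAt.exists_condExpOp_eq {Y : Ω → ℝ} {W : Ω → 𝒲} {Z : Ω → 𝒵} {A : Ω → 𝒜} {X : Ω → 𝒳}
    {a : 𝒜} {x : 𝒳} (hreg : RegularAt P Y W Z A X a x)
    (hker : ∀ g : Lp ℝ 2 (lawWZ P W Z A X a x).snd,
      ContinuousLinearMap.adjoint (condExpOp (lawWZ P W Z A X a x)) g = 0 →
      ∫ z, condMean P Y (fun ω => (Z ω, A ω, X ω)) (z, a, x) * g z
        ∂(lawWZ P W Z A X a x).snd = 0) :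
    ∃ h, condExpOp (lawWZ P W Z A X a x) h = hreg.mean_sq.toLp _ := by
  have : IsProbabilityMeasure (lawWZ P W Z A X a x) := by
    unfold lawWZ; infer_instance
  have hinner : ∀ g : Lp ℝ 2 (lawWZ P W Z A X a x).snd, ⟪hreg.mean_sq.toLp _, g⟫_ℝ =
      ∫ z, condMean P Y (fun ω => (Z ω, A ω, X ω)) (z, a, x) * g z
        ∂(lawWZ P W Z A X a x).snd := fun g => by
    rw [inner_Lp_two_eq_integral]
    refine integral_congr_ae ?_
    filter_upwards [hreg.mean_sq.coeFn_toLp] with z hz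
    rw [hz]
  obtain ⟨ι, ν, υ, κ, hS⟩ := exists_isSingularSystem_of_isCompactOperator
    (isCompactOperator_condExpOp _ hreg.absolutelyContinuous hreg.kernel_sq)
  refine hS.exists_apply_eq (fun g hg => (hinner g).trans (hker g hg)) ?_
  simpa only [hinner] using hreg.picard ι ν υ κ hS

end Solvability

theorem lemmaA2 {Ω 𝒲 𝒵 𝒰 𝒜 𝒳 : Type*}
    [MeasurableSpace Ω] [StandardBorelSpace Ω]
    [MeasurableSpace 𝒲] [StandardBorelSpace 𝒲] [Nonempty 𝒲]
    [MeasurableSpace 𝒵] [StandardBorelSpace 𝒵] [Nonempty 𝒵]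
    [MeasurableSpace 𝒰] [StandardBorelSpace 𝒰] [Nonempty 𝒰]
    [MeasurableSpace 𝒜] [StandardBorelSpace 𝒜]
    [MeasurableSpace 𝒳] [StandardBorelSpace 𝒳]
    (P : Measure Ω) [IsProbabilityMeasure P]
    (Y : Ω → ℝ) (W : Ω → 𝒲) (Z : Ω → 𝒵) (U : Ω → 𝒰) (A : Ω → 𝒜) (X : Ω → 𝒳)
    (hW : Measurable W) (hZ : Measurable Z) (hU : Measurable U)
    (hA : Measurable A) (hX : Measurable X)
    (hY : Measurable Y) (hYint : Integrable Y P)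
    -- negative control exposure: Z ⫫ Y ∣ A, U, X and Z ⫫ W ∣ A, U, X
    (hZY : CondIndepFun (MeasurableSpace.comap (fun ω => (A ω, U ω, X ω)) inferInstance)
      (hA.prodMk (hU.prodMk hX)).comap_le Z Y P)
    (hZW : CondIndepFun (MeasurableSpace.comap (fun ω => (A ω, U ω, X ω)) inferInstance)
      (hA.prodMk (hU.prodMk hX)).comap_le Z W P)
    -- relevance of W for U
    (hrel : ∀ᵐ c ∂(P.map fun ω => (A ω, X ω)), RelevantAt P W U A X c.1 c.2)
    -- regularity conditions
    (hreg : ∀ᵐ c ∂(P.map fun ω => (A ω, X ω)), RegularAt P Y W Z A X c.1 c.2)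
    -- E(Y ∣ a, u, x) is square integrable for F(u ∣ a, x)
    (hYU : ∀ᵐ c ∂(P.map fun ω => (A ω, X ω)),
      MemLp (fun u => condMean P Y (fun ω => (U ω, A ω, X ω)) (u, c.1, c.2)) 2
        (condDistrib U (fun ω => (A ω, X ω)) P c)) :
    ∃ h : 𝒲 → 𝒜 → 𝒳 → ℝ,
      Measurable (fun q : 𝒲 × 𝒜 × 𝒳 => h q.1 q.2.1 q.2.2) ∧
      (∀ᵐ c ∂(P.map fun ω => (A ω, X ω)),
        MemLp (fun w => h w c.1 c.2) 2 (condDistrib W (fun ω => (A ω, X ω)) P c)) ∧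
      ∀ᵐ t ∂(P.map fun ω => (Z ω, A ω, X ω)),
        Integrable (fun w => h w t.2.1 t.2.2)
          (condDistrib W (fun ω => (Z ω, A ω, X ω)) P t) ∧
        condMean P Y (fun ω => (Z ω, A ω, X ω)) t =
          ∫ w, h w t.2.1 t.2.2 ∂(condDistrib W (fun ω => (Z ω, A ω, X ω)) P t) := by
  have hC : Measurable fun ω => (A ω, X ω) := hA.prodMk hX
  have hcomap : MeasurableSpace.comap (fun ω => (A ω, U ω, X ω)) inferInstance =
      MeasurableSpace.comap (fun ω => (U ω, A ω, X ω)) inferInstance := by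
    refine le_antisymm (Measurable.comap_le ?_) (Measurable.comap_le ?_)
    · exact (by fun_prop : Measurable fun t : 𝒰 × 𝒜 × 𝒳 => (t.2.1, t.1, t.2.2)).comp
        (comap_measurable _)
    · exact (by fun_prop : Measurable fun t : 𝒜 × 𝒰 × 𝒳 => (t.2.1, t.1, t.2.2)).comp
        (comap_measurable _)
  have hker := ae_integral_condMean_mul_eq_zero (P := P) hW hZ hU hA hX hY hYint
    (hZY.of_measurableSpace_eq hcomap _) (hZW.of_measurableSpace_eq hcomap _) hrel hYU
  have hsnd := snd_condDistrib_ae_eq (P := P) (C := fun ω => (A ω, X ω)) hW hZ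
  have hmean : ∀ᵐ c ∂(P.map fun ω => (A ω, X ω)),
      MemLp (fun z => condMean P Y (fun ω => (Z ω, A ω, X ω)) (z, c)) 2
        (condDistrib Z (fun ω => (A ω, X ω)) P c) := by
    filter_upwards [hreg, hsnd] with c hc hs
    rw [← hs]
    exact hc.mean_sq
  obtain ⟨h, hh, hh2, hsol⟩ := exists_measurable_eq_integral_condDistrib hW hZ hC
    (stronglyMeasurable_condMean P Y fun ω => (Z ω, A ω, X ω)) hmean (by
      filter_upwards [hreg, hker, hsnd,
        fst_condDistrib_ae_eq (P := P) (C := fun ω => (A ω, X ω)) hW hZ,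
        condDistrib_prodMk_ae_eq (P := P) hW hZ hC] with c hc hk hs hf hθ
      -- The fibre solution `f` only supplies the constant in the bound; its dependence on `c` plays
      -- no role.
      obtain ⟨f, hf'⟩ := hc.exists_condExpOp_eq hk
      rw [← hs, ← hf]
      rw [← hf] at hθ
      exact exists_sq_integral_mul_le_of_condExpOp_eq
        (condDistrib (fun ω => (W ω, Z ω)) (fun ω => (A ω, X ω)) P c) _ hθ.symm hc.mean_sq hf')
  exact ⟨fun w a x => h (w, a, x), hh, hh2, hsol⟩
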